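/- For $n\ge 1$ let $\zeta_n=e^{2\pi i/n}$ and let $Y_n$ be the Sekine quantum group, i.e. the finite quantum group whose algebra of functions is $$F(Y_n)=\Big(\bigoplus_{i,j\in\mathbb Z/n}\mathbb C\,e_{(i,j)}\Big)\oplus M_n(\mathbb C),$$ where the $e_{(i,j)}$ are orthogonal projections, the $E_{i,j}$ ($i,j\in\mathbb Z/n$) are the matrix units of $M_n(\mathbb C)$, and the comultiplication is $$\Delta(e_{(i,j)})=\sum_{\ell,m\in\mathbb Z/n}e_{(\ell,m)}\otimes e_{(i-\ell,j-m)}+\frac1n\sum_{\ell,m\in\mathbb Z/n}\zeta_n^{i(\ell-m)}E_{\ell,m}\otimes E_{\ell+j,m+j},$$ $$\Delta(E_{i,j})=\sum_{\ell,m\in\mathbb Z/n}\zeta_n^{\ell(i-j)}e_{(-\ell,-m)}\otimes E_{i-m,j-m}+\sum_{\ell,m\in\mathbb Z/n}\zeta_n^{\ell(j-i)}E_{i-m,j-m}\otimes e_{(\ell,m)}.$$ Its counit is the coefficient of $e_{(0,0)}$ and its Haar state is $$\pi_{Y_n}\Big(\sum_{i,j} x_{(i,j)}e_{(i,j)}+a\Big)=\frac1{2n^2}\Big(\sum_{i,j}x_{(i,j)}+n\operatorname{Tr}(a)\Big).$$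 Let $\{e^{(i,j)}\}\cup\{E^{i,j}\}$ be the basis of the dual space dual to $\{e_{(i,j)}\}\cup\{E_{i,j}\}$. For functionals $\varphi,\psi$ on $F(Y_n)$ put $\varphi\star\psi=(\varphi\otimes\psi)\Delta$, let $\varphi^{\star k}$ be the $k$-th convolution power (with $\varphi^{\star 0}$ the counit), and let $$\|\varphi-\psi\|=\sup\{|\varphi(p)-\psi(p)| : p\in F(Y_n),\ p=p^2=p^*\}$$ be the total variation distance. Consider the state $$\nu_n=\tfrac18\big(e^{(0,1)}+e^{(1,0)}+e^{(-1,0)}+e^{(0,-1)}\big)+\tfrac1{2n}\sum_{p,q\in\mathbb Z/n}E^{p,q}.$$ **Proposition.** (1) There are real numbers $c_n$ with $c_n\to1$ as $n\to\infty$ such that for every odd $n\ge 3$ and every $k\in\mathbb N$ of the form $k=\alpha n^2$ with $\alpha\in\mathbb R$, $\alpha>1/20$, $$\tfrac12e^{-\alpha\pi^2/2}\le\|\nu_n^{\star k}-\pi_{Y_n}\|\le c_n\,e^{-\alpha\pi^2/4}$$ (in the exponents, $\pi$ is the number $3.14\ldots$). (2) Consequently the walks driven by $\nu_n$, $n=3,5,7,\dots$,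 do not exhibit the cut-off phenomenon: there are no times $t_n>0$ such that for every $0<\varepsilon<1$, as $n\to\infty$ through the odd integers, $\|\nu_n^{\star\lfloor(1-\varepsilon)t_n\rfloor}-\pi_{Y_n}\|\to1$ and $\|\nu_n^{\star\lfloor(1+\varepsilon)t_n\rfloor}-\pi_{Y_n}\|\to0$. -/

import Mathlib

namespace FiniteQuantumGroup

open scoped TensorProduct
open Filter Topology

noncomputable section

variable {A : Type*} [Ring A] [HopfAlgebra ℂ A]

/-- Linear functionals on `A = F(G)` that are positive and take the value `1` at the unit. -/
def IsState [StarRing A] (φ : A →ₗ[ℂ] ℂ) : Prop :=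
  (∀ a : A, 0 ≤ (φ (star a * a)).re ∧ (φ (star a * a)).im = 0) ∧ φ 1 = 1

/-- A state `h` with `(id ⊗ h) Δ(a) = h(a) 1 = (h ⊗ id) Δ(a)` for all `a`. -/
def IsHaarState [StarRing A] (h : A →ₗ[ℂ] ℂ) : Prop :=
  IsState h ∧ ∀ a : A,
    TensorProduct.rid ℂ A (h.lTensor A (Coalgebra.comul (R := ℂ) a)) = h a • (1 : A) ∧
    TensorProduct.lid ℂ A (h.rTensor A (Coalgebra.comul (R := ℂ) a)) = h a • (1 : A)

/-- The `k`-fold convolution power `φ ⋆ ⋯ ⋆ φ` for `φ ⋆ ψ = (φ ⊗ ψ) ∘ Δ`; the power with `k = 0`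
is the counit. -/
def convPow (φ : A →ₗ[ℂ] ℂ) (k : ℕ) : A →ₗ[ℂ] ℂ :=
  (WithConv.toConv φ ^ k).ofConv

/-- The total variation distance: the supremum of `|φ(p) - ψ(p)|` over all projections
`p = p² = p*` of `A`. -/
def tvDist [StarRing A] (φ ψ : A →ₗ[ℂ] ℂ) : ℝ :=
  ⨆ p : {p : A // IsStarProjection p}, ‖φ p - ψ p‖

/-- The cut-off phenomenon for a family of random walks, where `d m k` is the distance to
random of the `m`-th walk after `k` steps: there are cut-off times `t m` such that for each
`0 < ε < 1` the distance tends to `1` at time `(1 - ε) t m` and to `0` at time `(1 + ε) t m`. -/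
def HasCutoff (d : ℕ → ℕ → ℝ) : Prop :=
  ∃ t : ℕ → ℝ, (∀ m, 0 < t m) ∧ ∀ ε : ℝ, 0 < ε → ε < 1 →
    Tendsto (fun m => d m ⌊(1 - ε) * t m⌋₊) atTop (𝓝 1) ∧
    Tendsto (fun m => d m ⌊(1 + ε) * t m⌋₊) atTop (𝓝 0)

/-- The convolution powers are given by `φ^{⋆(k+1)} = (φ ⊗ φ^{⋆k}) ∘ Δ`. -/
lemma convPow_succ (φ : A →ₗ[ℂ] ℂ) (k : ℕ) :
    convPow φ (k + 1) =
      LinearMap.mul' ℂ ℂ ∘ₗ TensorProduct.map φ (convPow φ k) ∘ₗ Coalgebra.comul := by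
  unfold convPow
  rw [pow_succ']
  rfl

lemma convPow_one (φ : A →ₗ[ℂ] ℂ) : convPow φ 1 = φ := by
  unfold convPow
  rw [pow_one]

end

end FiniteQuantumGroup

namespace Sekine

open scoped TensorProduct

noncomputable section

set_option linter.unusedSimpArgs false

/-- The algebra of functions `F(Y_n) = (⨁_{i,j ∈ ℤ/n} ℂ e_{(i,j)}) ⊕ M_n(ℂ)` on the Sekine quantum
group `Y_n`, with the rows and columns of the matrices indexed by `ℤ/n`. -/
def FunAlg (n : ℕ) : Type := (ZMod n × ZMod n → ℂ) × Matrix (ZMod n) (ZMod n) ℂ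

variable {n : ℕ} [NeZero n]

instance : Ring (FunAlg n) :=
  inferInstanceAs (Ring ((ZMod n × ZMod n → ℂ) × Matrix (ZMod n) (ZMod n) ℂ))

instance : Algebra ℂ (FunAlg n) :=
  inferInstanceAs (Algebra ℂ ((ZMod n × ZMod n → ℂ) × Matrix (ZMod n) (ZMod n) ℂ))

instance : StarRing (FunAlg n) :=
  inferInstanceAs (StarRing ((ZMod n × ZMod n → ℂ) × Matrix (ZMod n) (ZMod n) ℂ))

instance : StarModule ℂ (FunAlg n) :=
  inferInstanceAs (StarModule ℂ ((ZMod n × ZMod n → ℂ) × Matrix (ZMod n) (ZMod n) ℂ))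

/-- The basis element `e_{(i,j)}` of the commutative summand. -/
def e (i j : ZMod n) : FunAlg n := (Pi.single (i, j) 1, 0)

/-- The matrix unit `E_{i,j}` of the summand `M_n(ℂ)`. -/
def E (i j : ZMod n) : FunAlg n := (0, Matrix.single i j 1)

/-- The element `e^{(i,j)}` of the dual basis. -/
def eDual (i j : ZMod n) : FunAlg n →ₗ[ℂ] ℂ where
  toFun x := x.1 (i, j)
  map_add' _ _ := rfl
  map_smul' _ _ := rfl

/-- The element `E^{i,j}` of the dual basis. -/
def EDual (i j : ZMod n) : FunAlg n →ₗ[ℂ] ℂ where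
  toFun x := x.2 i j
  map_add' _ _ := rfl
  map_smul' _ _ := rfl

/-- The linear map with `e_{(i,j)} ↦ f i j` and `E_{i,j} ↦ g i j`. -/
def linExt {M : Type*} [AddCommGroup M] [Module ℂ M] (f g : ZMod n → ZMod n → M) :
    FunAlg n →ₗ[ℂ] M :=
  ∑ i, ∑ j, ((eDual i j).smulRight (f i j) + (EDual i j).smulRight (g i j))

lemma eDual_e (i j k l : ZMod n) :
    eDual i j (e k l) = if k = i ∧ l = j then 1 else 0 := by
  change (Pi.single (k, l) 1 : ZMod n × ZMod n → ℂ) (i, j) = _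
  simp [Pi.single_apply, eq_comm]

lemma eDual_E (i j k l : ZMod n) : eDual i j (E k l) = 0 := rfl

lemma EDual_e (i j k l : ZMod n) : EDual i j (e k l) = 0 := rfl

lemma EDual_E (i j k l : ZMod n) :
    EDual i j (E k l) = if k = i ∧ l = j then 1 else 0 := by
  change Matrix.single k l (1 : ℂ) i j = _
  simp [Matrix.single_apply]

lemma sum_ite2 {M : Type*} [AddCommMonoid M] (a b : ZMod n) (f : ZMod n → ZMod n → M) :
    (∑ i, ∑ j, if a = i ∧ b = j then f i j else 0) = f a b := by
  simp [ite_and]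

lemma linExt_e {M : Type*} [AddCommGroup M] [Module ℂ M] (f g : ZMod n → ZMod n → M)
    (i j : ZMod n) : linExt f g (e i j) = f i j := by
  simp [linExt, LinearMap.sum_apply, eDual_e, EDual_e, ite_smul, sum_ite2]

lemma linExt_E {M : Type*} [AddCommGroup M] [Module ℂ M] (f g : ZMod n → ZMod n → M)
    (i j : ZMod n) : linExt f g (E i j) = g i j := by
  simp [linExt, LinearMap.sum_apply, eDual_E, EDual_E, ite_smul, sum_ite2]

lemma eq_sum (x : FunAlg n) : x = ∑ i, ∑ j, (eDual i j x • e i j + EDual i j x • E i j) := by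
  have h1 : ∀ s : ZMod n × ZMod n → FunAlg n, (∑ p, s p).1 = ∑ p, (s p).1 := fun s =>
    map_sum (AddMonoidHom.fst (ZMod n × ZMod n → ℂ) (Matrix (ZMod n) (ZMod n) ℂ)) s _
  have h2 : ∀ s : ZMod n × ZMod n → FunAlg n, (∑ p, s p).2 = ∑ p, (s p).2 := fun s =>
    map_sum (AddMonoidHom.snd (ZMod n × ZMod n → ℂ) (Matrix (ZMod n) (ZMod n) ℂ)) s _
  rw [← Fintype.sum_prod_type']
  refine Prod.ext ?_ ?_
  · rw [h1]
    funext q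
    rw [Finset.sum_apply]
    change x.1 q = ∑ p : ZMod n × ZMod n,
      (x.1 (p.1, p.2) * (Pi.single (p.1, p.2) (1 : ℂ) : ZMod n × ZMod n → ℂ) q + x.2 p.1 p.2 * 0)
    simp [Pi.single_apply]
  · rw [h2]
    ext a b
    rw [Matrix.sum_apply]
    change x.2 a b = ∑ p : ZMod n × ZMod n,
      (x.1 (p.1, p.2) * 0 + x.2 p.1 p.2 * Matrix.single p.1 p.2 (1 : ℂ) a b)
    simp [Matrix.single_apply, Fintype.sum_prod_type, ite_and]

lemma hom_ext {M : Type*} [AddCommGroup M] [Module ℂ M] {f g : FunAlg n →ₗ[ℂ] M}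
    (he : ∀ i j, f (e i j) = g (e i j)) (hE : ∀ i j, f (E i j) = g (E i j)) : f = g := by
  ext x
  rw [eq_sum x]
  simp [he, hE]

/-- `Δ(e_{(i,j)}) = ∑ e_{(l,m)} ⊗ e_{(i-l,j-m)} + (1/n) ∑ ζ^{i(l-m)} E_{l,m} ⊗ E_{l+j,m+j}`, where
`ζ^a = exp(2πia/n)` is `ZMod.stdAddChar a`. -/
def comulOne (i j : ZMod n) : FunAlg n ⊗[ℂ] FunAlg n :=
  (∑ l, ∑ m, e l m ⊗ₜ[ℂ] e (i - l) (j - m)) +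
    (1 / n : ℂ) • ∑ l, ∑ m, ZMod.stdAddChar (i * (l - m)) • (E l m ⊗ₜ[ℂ] E (l + j) (m + j))

/-- `Δ(E_{i,j}) = ∑ e_{(-l,-m)} ⊗ ζ^{l(i-j)} E_{i-m,j-m} + ∑ ζ^{l(j-i)} E_{i-m,j-m} ⊗ e_{(l,m)}`. -/
def comulMat (i j : ZMod n) : FunAlg n ⊗[ℂ] FunAlg n :=
  (∑ l, ∑ m, ZMod.stdAddChar (l * (i - j)) • (e (-l) (-m) ⊗ₜ[ℂ] E (i - m) (j - m))) +
    ∑ l, ∑ m, ZMod.stdAddChar (l * (j - i)) • (E (i - m) (j - m) ⊗ₜ[ℂ] e l m)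

/-- The counit is the coefficient of `e_{(0,0)}`. -/
instance : CoalgebraStruct ℂ (FunAlg n) where
  comul := linExt comulOne comulMat
  counit := eDual 0 0

lemma comul_e (i j : ZMod n) : Coalgebra.comul (R := ℂ) (e i j) = comulOne i j := linExt_e _ _ _ _
lemma comul_E (i j : ZMod n) : Coalgebra.comul (R := ℂ) (E i j) = comulMat i j := linExt_E _ _ _ _
lemma counit_e (i j : ZMod n) : Coalgebra.counit (R := ℂ) (e i j) = if i = 0 ∧ j = 0 then 1 else 0 :=
  eDual_e _ _ _ _
lemma counit_E (i j : ZMod n) : Coalgebra.counit (R := ℂ) (E i j) = 0 := rfl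

lemma sum4_congr {M : Type*} [AddCommMonoid M] {f g : ZMod n → ZMod n → ZMod n → ZMod n → M}
    (a b : ZMod n × ZMod n × ZMod n × ZMod n → ZMod n × ZMod n × ZMod n × ZMod n)
    (hba : ∀ x, b (a x) = x) (hab : ∀ x, a (b x) = x)
    (h : ∀ x, f x.1 x.2.1 x.2.2.1 x.2.2.2 =
      g (a x).1 (a x).2.1 (a x).2.2.1 (a x).2.2.2) :
    ∑ p, ∑ q, ∑ r, ∑ s, f p q r s = ∑ p, ∑ q, ∑ r, ∑ s, g p q r s := by
  have key : ∀ u : ZMod n → ZMod n → ZMod n → ZMod n → M, ∑ p, ∑ q, ∑ r, ∑ s, u p q r s =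
      ∑ x : ZMod n × ZMod n × ZMod n × ZMod n, u x.1 x.2.1 x.2.2.1 x.2.2.2 := by
    intro u; simp [Fintype.sum_prod_type]
  rw [key, key]
  exact Fintype.sum_equiv ⟨a, b, hba, hab⟩ _ _ h


lemma add4_congr {M : Type*} [AddCommMonoid M] {a b c d a' b' c' d' : M}
    (h1 : a = a') (h2 : b = d') (h3 : c = b') (h4 : d = c') :
    a + b + (c + d) = a' + b' + (c' + d') := by
  subst h1 h2 h3 h4; abel

lemma add4_congr' {M : Type*} [AddCommMonoid M] {a b c d a' b' c' d' : M}
    (h1 : a = a') (h2 : b = d') (h3 : c = c') (h4 : d = b') :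
    a + b + (c + d) = a' + b' + (c' + d') := by
  subst h1 h2 h3 h4; abel

lemma sum3_congr {M : Type*} [AddCommMonoid M] {f g : ZMod n → ZMod n → ZMod n → M}
    (a b : ZMod n × ZMod n × ZMod n → ZMod n × ZMod n × ZMod n)
    (hba : ∀ x, b (a x) = x) (hab : ∀ x, a (b x) = x)
    (h : ∀ x, f x.1 x.2.1 x.2.2 = g (a x).1 (a x).2.1 (a x).2.2) :
    ∑ p, ∑ q, ∑ r, f p q r = ∑ p, ∑ q, ∑ r, g p q r := by
  have key : ∀ u : ZMod n → ZMod n → ZMod n → M, ∑ p, ∑ q, ∑ r, u p q r =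
      ∑ x : ZMod n × ZMod n × ZMod n, u x.1 x.2.1 x.2.2 := by
    intro u; simp [Fintype.sum_prod_type]
  rw [key, key]
  exact Fintype.sum_equiv ⟨a, b, hba, hab⟩ _ _ h

lemma sum_char (a : ZMod n) : ∑ l : ZMod n, ZMod.stdAddChar (l * a) = if a = 0 then (n : ℂ) else 0 := by
  have := AddChar.sum_mulShift a (ZMod.isPrimitive_stdAddChar n)
  simpa [ZMod.card] using this

lemma sum_diag {M : Type*} [AddCommGroup M] [Module ℂ M] (i j : ZMod n)
    (f : ZMod n → ZMod n → M) :
    ∑ l, ∑ p, ∑ q, (1 / n * ZMod.stdAddChar (l * (p - q - (i - j))) : ℂ) • f p q =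
      ∑ y, f (i - y) (j - y) := by
  have h : ∀ p q : ZMod n, ∑ l, (1 / n * ZMod.stdAddChar (l * (p - q - (i - j))) : ℂ) • f p q =
      if q = p - (i - j) then f p q else 0 := by
    intro p q
    have hn : (n : ℂ) ≠ 0 := by exact_mod_cast NeZero.ne n
    have hq : p - q - (i - j) = 0 ↔ q = p - (i - j) := by
      rw [sub_right_comm, sub_eq_zero, eq_comm]
    rw [← Finset.sum_smul, ← Finset.mul_sum, sum_char]
    simp only [hq]
    split_ifs <;> simp [hn]
  rw [Finset.sum_comm]
  simp_rw [Finset.sum_comm (s := Finset.univ (α := ZMod n)) (f := fun l q => _ • f _ q), h]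
  simp only [Finset.sum_ite_eq', Finset.mem_univ, if_true]
  refine Fintype.sum_equiv (Equiv.subLeft i) _ _ fun p => ?_
  simp only [Equiv.subLeft_apply]
  congr 1 <;> ring

open TensorProduct in
instance : Coalgebra ℂ (FunAlg n) where
  coassoc := by
    refine hom_ext (fun i j => ?_) (fun i j => ?_)
    · simp only [LinearMap.comp_apply, comul_e, comul_E, comulOne, comulMat, map_add, map_sum, map_smul,
        LinearMap.rTensor_tmul, LinearMap.lTensor_tmul, add_tmul, tmul_add, sum_tmul, tmul_sum,
        LinearEquiv.coe_coe, assoc_tmul, ← smul_tmul', tmul_smul, smul_add, Finset.smul_sum,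
        Finset.sum_add_distrib, smul_smul]
      refine add4_congr ?_ ?_ ?_ ?_
      · refine sum4_congr (fun x => (x.2.2.1, x.2.2.2, x.1 - x.2.2.1, x.2.1 - x.2.2.2))
          (fun x => (x.1 + x.2.2.1, x.2.1 + x.2.2.2, x.1, x.2.1)) ?_ ?_ ?_ <;>
        rintro ⟨l, m, p, q⟩ <;> simp [sub_sub]
      · refine sum4_congr (fun x => (x.2.2.1, x.2.2.2, i - x.1, j - x.2.1))
          (fun x => (i - x.2.2.1, j - x.2.2.2, x.1, x.2.1)) ?_ ?_ ?_ <;>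
        rintro ⟨l, m, p, q⟩ <;> simp [mul_assoc, ← AddChar.map_add_eq_mul]
        ring_nf
      · refine sum4_congr (fun x => (-x.2.2.1, -x.2.2.2, x.1 - x.2.2.2, x.2.1 - x.2.2.2))
          (fun x => (x.2.2.1 - x.2.1, x.2.2.2 - x.2.1, -x.1, -x.2.1)) ?_ ?_ ?_ <;>
        rintro ⟨l, m, p, q⟩ <;> simp [mul_assoc, ← AddChar.map_add_eq_mul]
        ring_nf
      · refine sum4_congr (fun x => (x.1 - x.2.2.2, x.2.1 - x.2.2.2, -x.2.2.1, -x.2.2.2))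
          (fun x => (x.1 - x.2.2.2, x.2.1 - x.2.2.2, -x.2.2.1, -x.2.2.2)) ?_ ?_ ?_ <;>
        rintro ⟨l, m, p, q⟩ <;> simp [mul_assoc, ← AddChar.map_add_eq_mul]
        ring_nf
    · simp only [LinearMap.comp_apply, comul_e, comul_E, comulOne, comulMat, map_add, map_sum, map_smul,
        LinearMap.rTensor_tmul, LinearMap.lTensor_tmul, add_tmul, tmul_add, sum_tmul, tmul_sum,
        LinearEquiv.coe_coe, assoc_tmul, ← smul_tmul', tmul_smul, smul_add, Finset.smul_sum,
        Finset.sum_add_distrib, smul_smul]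
      refine add4_congr ?_ ?_ ?_ ?_
      · refine sum4_congr (fun x => (-x.2.2.1, -x.2.2.2, x.1 + x.2.2.1, x.2.1 + x.2.2.2))
          (fun x => (x.1 + x.2.2.1, x.2.1 + x.2.2.2, -x.1, -x.2.1)) ?_ ?_ ?_ <;>
        rintro ⟨l, m, p, q⟩ <;> simp [mul_assoc, ← AddChar.map_add_eq_mul]
        ring_nf
      · rw [Finset.sum_comm]
        have h1 := fun m : ZMod n => sum_diag i j (fun p q =>
          E p q ⊗ₜ[ℂ] (E (p + -m) (q + -m) ⊗ₜ[ℂ] E (i - m) (j - m)))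
        have h2 := fun m : ZMod n => sum_diag i j (fun p q =>
          E (i - m) (j - m) ⊗ₜ[ℂ] (E p q ⊗ₜ[ℂ] E (p + m) (q + m)))
        trans ∑ m, ∑ y, E (i - y) (j - y) ⊗ₜ[ℂ]
          (E (i - y + -m) (j - y + -m) ⊗ₜ[ℂ] E (i - m) (j - m))
        · refine Finset.sum_congr rfl fun m _ => ?_
          rw [← h1]
          refine Fintype.sum_equiv (Equiv.neg _) _ _ fun l => ?_
          refine Finset.sum_congr rfl fun p _ => Finset.sum_congr rfl fun q _ => ?_
          rw [mul_left_comm, ← AddChar.map_add_eq_mul]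
          simp only [Equiv.neg_apply]
          ring_nf
        · symm
          rw [Finset.sum_comm]
          trans ∑ y, ∑ m, E (i - y) (j - y) ⊗ₜ[ℂ]
            (E (i - m) (j - m) ⊗ₜ[ℂ] E (i - m + y) (j - m + y))
          · refine Finset.sum_congr rfl fun m _ => ?_
            rw [← h2]
            refine Finset.sum_congr rfl fun l _ => ?_
            refine Finset.sum_congr rfl fun p _ => Finset.sum_congr rfl fun q _ => ?_
            rw [mul_left_comm, ← AddChar.map_add_eq_mul]
            ring_nf
          · rw [Finset.sum_comm (s := Finset.univ (α := ZMod n))]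
            rw [Finset.sum_comm]
            rw [Finset.sum_comm (f := fun m y => E (i - y) (j - y) ⊗ₜ[ℂ]
              (E (i - y + -m) (j - y + -m) ⊗ₜ[ℂ] E (i - m) (j - m)))]
            refine Finset.sum_congr rfl fun y _ => ?_
            refine Fintype.sum_equiv (Equiv.subRight y) _ _ fun m => ?_
            simp only [Equiv.subRight_apply]
            ring_nf
      · refine sum4_congr (fun x => (x.2.2.1, x.2.2.2, x.1, x.2.1))
          (fun x => (x.2.2.1, x.2.2.2, x.1, x.2.1)) ?_ ?_ ?_ <;>
        rintro ⟨l, m, p, q⟩ <;> simp [mul_assoc, ← AddChar.map_add_eq_mul]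
        ring_nf
      · refine sum4_congr (fun x => (x.1 + x.2.2.1, x.2.1 + x.2.2.2, x.2.2.1, x.2.2.2))
          (fun x => (x.1 - x.2.2.1, x.2.1 - x.2.2.2, x.2.2.1, x.2.2.2)) ?_ ?_ ?_ <;>
        rintro ⟨l, m, p, q⟩ <;> simp [mul_assoc, ← AddChar.map_add_eq_mul]
        ring_nf
  rTensor_counit_comp_comul := by
    refine hom_ext (fun i j => ?_) (fun i j => ?_)
    · simp [comul_e, comulOne, counit_e, counit_E, ite_tmul, ite_and]
    · simp [comul_E, comulMat, counit_e, counit_E, ite_tmul, ite_and]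
  lTensor_counit_comp_comul := by
    refine hom_ext (fun i j => ?_) (fun i j => ?_)
    · simp [comul_e, comulOne, counit_e, counit_E, tmul_ite, ite_and, sub_eq_zero]
    · simp [comul_E, comulMat, counit_e, counit_E, tmul_ite, ite_and]


lemma e_mul_e (i j k l : ZMod n) : e i j * e k l = if i = k ∧ j = l then e i j else 0 := by
  refine Prod.ext ?_ ?_
  · funext q
    change (Pi.single (i, j) 1 : ZMod n × ZMod n → ℂ) q * (Pi.single (k, l) 1 : ZMod n × ZMod n → ℂ) q
      = (if i = k ∧ j = l then e i j else 0 : FunAlg n).1 q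
    split_ifs with h
    · obtain ⟨rfl, rfl⟩ := h
      change _ = (Pi.single (i, j) 1 : ZMod n × ZMod n → ℂ) q
      simp [Pi.single_apply]
    · change _ = (0 : ℂ)
      simp only [Pi.single_apply]
      by_cases h1 : q = (i, j)
      · subst h1; simp; tauto
      · simp [h1]
  · split_ifs <;> exact mul_zero (0 : Matrix (ZMod n) (ZMod n) ℂ)

lemma e_mul_E (i j k l : ZMod n) : e i j * E k l = 0 :=
  Prod.ext (mul_zero (Pi.single (i, j) 1 : ZMod n × ZMod n → ℂ)) (zero_mul (Matrix.single k l (1 : ℂ)))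

lemma E_mul_e (i j k l : ZMod n) : E i j * e k l = 0 :=
  Prod.ext (zero_mul (Pi.single (k, l) 1 : ZMod n × ZMod n → ℂ)) (mul_zero (Matrix.single i j (1 : ℂ)))

lemma E_mul_E (i j k l : ZMod n) : E i j * E k l = if j = k then E i l else 0 := by
  refine Prod.ext ?_ ?_
  · split_ifs <;> exact mul_zero (0 : ZMod n × ZMod n → ℂ)
  · change Matrix.single i j (1 : ℂ) * Matrix.single k l (1 : ℂ) = _
    split_ifs with h
    · subst h; simp; rfl
    · rw [Matrix.single_mul_single_of_ne _ _ _ _ h]; rfl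

lemma one_eq : (1 : FunAlg n) = (∑ i, ∑ j, e i j) + ∑ i, E i i := by
  have h1 : ∀ i j : ZMod n, eDual i j (1 : FunAlg n) = 1 := fun _ _ => rfl
  have h2 : ∀ i j : ZMod n, EDual i j (1 : FunAlg n) = if i = j then 1 else 0 :=
    fun _ _ => Matrix.one_apply
  conv_lhs => rw [eq_sum 1]
  simp [h1, h2, Finset.sum_add_distrib]

lemma star_e (i j : ZMod n) : star (e i j) = e i j := by
  refine Prod.ext ?_ (star_zero (Matrix (ZMod n) (ZMod n) ℂ))
  change star (Pi.single (i, j) 1 : ZMod n × ZMod n → ℂ) = (Pi.single (i, j) 1 : ZMod n × ZMod n → ℂ)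
  ext q
  simp [Pi.single_apply, apply_ite]

lemma star_E (i j : ZMod n) : star (E i j) = E j i := by
  refine Prod.ext (star_zero (ZMod n × ZMod n → ℂ)) ?_
  change star (Matrix.single i j (1 : ℂ)) = Matrix.single j i (1 : ℂ)
  simp [Matrix.star_eq_conjTranspose]


open TensorProduct in
instance : Bialgebra ℂ (FunAlg n) := by
  refine Bialgebra.mk' ℂ (FunAlg n) ?_ ?_ ?_ ?_
  · rfl
  · intro a b; rfl
  · have hn : (n : ℂ) ≠ 0 := by exact_mod_cast NeZero.ne n
    have h1 : ∀ j l m : ZMod n, ∑ i : ZMod n, (1 / (n : ℂ)) • ZMod.stdAddChar (i * (l - m)) •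
        (E l m ⊗ₜ[ℂ] E (l + j) (m + j)) = if m = l then E l m ⊗ₜ[ℂ] E (l + j) (m + j) else 0 := by
      intro j l m
      rw [← Finset.smul_sum, ← Finset.sum_smul, sum_char, smul_smul]
      by_cases h : m = l
      · subst h; simp [hn]
      · simp [h, sub_eq_zero, Ne.symm h]
    rw [Algebra.TensorProduct.one_def, one_eq]
    simp only [map_add, map_sum]
    change (∑ i, ∑ j, Coalgebra.comul (R := ℂ) (e i j)) + ∑ i, Coalgebra.comul (R := ℂ) (E i i) = _
    simp only [comul_e, comul_E, comulOne, comulMat, Finset.sum_add_distrib,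
      add_tmul, tmul_add, sum_tmul, tmul_sum, sub_self, mul_zero, AddChar.map_zero_eq_one, one_smul]
    refine add4_congr' ?_ ?_ ?_ ?_
    · refine sum4_congr (fun x => (x.1 - x.2.2.1, x.2.1 - x.2.2.2, x.2.2.1, x.2.2.2))
        (fun x => (x.1 + x.2.2.1, x.2.1 + x.2.2.2, x.2.2.1, x.2.2.2)) ?_ ?_ ?_ <;>
      rintro ⟨l, m, p, q⟩ <;> simp
    · trans ∑ j, ∑ l, ∑ m, if m = l then E l m ⊗ₜ[ℂ] E (l + j) (m + j) else 0
      · rw [Finset.sum_comm]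
        refine Finset.sum_congr rfl fun j _ => ?_
        simp only [← h1, Finset.smul_sum]
        rw [Finset.sum_comm]
        refine Finset.sum_congr rfl fun l _ => ?_
        rw [Finset.sum_comm]
      · rw [Finset.sum_comm]
        conv_rhs => rw [Finset.sum_comm]
        refine Finset.sum_congr rfl fun l _ => ?_
        simp only [Finset.sum_ite_eq', Finset.mem_univ, if_true]
        exact Fintype.sum_equiv (Equiv.addLeft l) _ _ fun x => rfl
    · refine sum3_congr (fun x => (x.1 - x.2.2, -x.2.1, -x.2.2))
        (fun x => (x.1 - x.2.2, -x.2.1, -x.2.2)) ?_ ?_ ?_ <;>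
      rintro ⟨l, m, p⟩ <;> simp
    · refine sum3_congr (fun x => (x.2.1, x.2.2, x.1 - x.2.2))
        (fun x => (x.2.2 + x.2.1, x.1, x.2.1)) ?_ ?_ ?_ <;>
      rintro ⟨l, m, p⟩ <;> simp
  · intro a b
    have h : (LinearMap.mul ℂ (FunAlg n)).compr₂ Coalgebra.comul =
      (LinearMap.mul ℂ (FunAlg n ⊗[ℂ] FunAlg n)).compl₁₂ Coalgebra.comul Coalgebra.comul := by
      refine hom_ext (fun i j => hom_ext (fun k l => ?_) (fun k l => ?_))
        (fun i j => hom_ext (fun k l => ?_) (fun k l => ?_)) <;>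
      simp only [LinearMap.compr₂_apply, LinearMap.compl₁₂_apply, LinearMap.mul_apply', e_mul_e,
        e_mul_E, E_mul_e, E_mul_E, map_zero, comul_e, comul_E]
      · simp only [apply_ite Coalgebra.comul, comul_e, map_zero, comulOne, add_mul, mul_add, Finset.sum_mul, Finset.mul_sum, Finset.smul_sum,
          smul_mul_assoc, mul_smul_comm, Algebra.TensorProduct.tmul_mul_tmul, e_mul_e, e_mul_E,
          E_mul_e, E_mul_E, tmul_zero, zero_tmul, smul_zero, Finset.sum_const_zero, add_zero, zero_add]
        have hn : (n : ℂ) ≠ 0 := by exact_mod_cast NeZero.ne n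
        have h2 : ∑ x, ∑ x_1, ∑ x_2, ∑ x_3, (1 / (n : ℂ)) • ZMod.stdAddChar (k * (x - x_1)) •
            (1 / (n : ℂ)) • ZMod.stdAddChar (i * (x_2 - x_3)) •
            ((if x_3 = x then E x_2 x_1 else 0 : FunAlg n) ⊗ₜ[ℂ]
              (if x_3 + j = x + l then E (x_2 + j) (x_1 + l) else 0 : FunAlg n)) =
            if i = k ∧ j = l then ∑ x, ∑ x_1, (1 / (n : ℂ)) • ZMod.stdAddChar (i * (x - x_1)) •
              (E x x_1 ⊗ₜ[ℂ] E (x + j) (x_1 + j)) else 0 := by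
          by_cases hjl : j = l
          · subst hjl
            have h3 : ∀ x_1 x_2 : ZMod n, ∑ x, (1 / (n : ℂ)) • ZMod.stdAddChar (k * (x - x_1)) •
                (1 / (n : ℂ)) • ZMod.stdAddChar (i * (x_2 - x)) •
                (E x_2 x_1 ⊗ₜ[ℂ] E (x_2 + j) (x_1 + j)) = if i = k then
                (1 / (n : ℂ)) • ZMod.stdAddChar (i * (x_2 - x_1)) •
                (E x_2 x_1 ⊗ₜ[ℂ] E (x_2 + j) (x_1 + j)) else 0 := by
              intro x_1 x_2
              have h4 : ∀ x : ZMod n, (1 / (n : ℂ)) * (ZMod.stdAddChar (k * (x - x_1)) *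
                  ((1 / (n : ℂ)) * ZMod.stdAddChar (i * (x_2 - x)))) =
                  (1 / (n : ℂ)) * (1 / (n : ℂ)) * ZMod.stdAddChar (i * x_2 - k * x_1) *
                    ZMod.stdAddChar (x * (k - i)) := by
                intro x
                rw [mul_assoc _ (ZMod.stdAddChar _), ← AddChar.map_add_eq_mul,
                  show i * x_2 - k * x_1 + x * (k - i) = k * (x - x_1) + i * (x_2 - x) by ring,
                  AddChar.map_add_eq_mul]
                ring
              simp only [smul_smul, h4]
              rw [← Finset.sum_smul, ← Finset.mul_sum, sum_char]
              by_cases hik : i = k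
              · subst hik
                simp only [sub_self, if_true, mul_sub]
                congr 1
                field_simp
              · simp [hik, sub_eq_zero, Ne.symm hik]
            simp only [add_left_inj, ite_tmul, tmul_ite, tmul_zero, zero_tmul, smul_ite, smul_zero, and_true,
              Finset.sum_ite_eq', Finset.mem_univ, if_true, ite_self]
            trans ∑ x_1, ∑ x_2, if i = k then
                (1 / (n : ℂ)) • ZMod.stdAddChar (i * (x_2 - x_1)) •
                (E x_2 x_1 ⊗ₜ[ℂ] E (x_2 + j) (x_1 + j)) else 0
            · rw [Finset.sum_comm]
              refine Finset.sum_congr rfl fun x_1 _ => ?_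
              rw [Finset.sum_comm]
              exact Finset.sum_congr rfl fun x_2 _ => h3 _ _
            · rw [Finset.sum_comm]
              split_ifs <;> simp
          · simp only [hjl, and_false, if_false]
            refine Finset.sum_eq_zero fun x _ => Finset.sum_eq_zero fun x_1 _ =>
              Finset.sum_eq_zero fun x_2 _ => Finset.sum_eq_zero fun x_3 _ => ?_
            by_cases h5 : x_3 = x
            · subst h5; simp [hjl]
            · simp [h5]
        rw [h2]
        by_cases hc : i = k ∧ j = l
        · obtain ⟨rfl, rfl⟩ := hc
          simp [ite_tmul, ite_and]
        · have : ∀ x x_1 x_2 x_3 : ZMod n, ((if x_2 = x ∧ x_3 = x_1 then e x_2 x_3 else 0 : FunAlg n) ⊗ₜ[ℂ]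
                (if i - x_2 = k - x ∧ j - x_3 = l - x_1 then e (i - x_2) (j - x_3) else 0 : FunAlg n)) = 0 := by
            intro x x_1 x_2 x_3
            by_cases h6 : x_2 = x ∧ x_3 = x_1
            · obtain ⟨rfl, rfl⟩ := h6
              simp [hc]
            · simp [h6]
          simp [hc, this]
      · simp [comulOne, comulMat, add_mul, mul_add, Finset.sum_mul, Finset.mul_sum,
          e_mul_e, e_mul_E, E_mul_e, E_mul_E]
      · simp [comulOne, comulMat, add_mul, mul_add, Finset.sum_mul, Finset.mul_sum,
          e_mul_e, e_mul_E, E_mul_e, E_mul_E]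
      · simp only [apply_ite Coalgebra.comul, comul_E, map_zero, comulMat, add_mul, mul_add, Finset.sum_mul, Finset.mul_sum, Finset.smul_sum,
          smul_mul_assoc, mul_smul_comm, Algebra.TensorProduct.tmul_mul_tmul, e_mul_e, e_mul_E,
          E_mul_e, E_mul_E, tmul_zero, zero_tmul, smul_zero, Finset.sum_const_zero, add_zero, zero_add]
        by_cases hjk : j = k
        · subst hjk
          simp [ite_tmul, tmul_ite, ite_and, smul_smul, ← AddChar.map_add_eq_mul, ← mul_add]
        · simp only [hjk, if_false]
          symm
          have h5 : ∀ {y z : ZMod n}, y = z → ¬ (j - y = k - z) := by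
            rintro y z rfl h; exact hjk (sub_left_inj.mp h)
          refine (congrArg₂ (· + ·) ?_ ?_).trans (add_zero 0) <;>
          · refine Finset.sum_eq_zero fun x _ => Finset.sum_eq_zero fun x_1 _ =>
              Finset.sum_eq_zero fun x_2 _ => Finset.sum_eq_zero fun x_3 _ => ?_
            by_cases h6 : x_3 = x_1
            · simp [h5 h6]
            · simp [h6]
    exact LinearMap.congr_fun₂ h a b

open TensorProduct in
/-- The antipode is `e_{(i,j)} ↦ e_{(-i,-j)}` and the transpose on `M_n(ℂ)`. -/
instance : HopfAlgebra ℂ (FunAlg n) where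
  antipode := linExt (fun i j => e (-i) (-j)) (fun i j => E j i)
  mul_antipode_rTensor_comul := by
    refine hom_ext (fun i j => ?_) (fun i j => ?_)
    · rw [LinearMap.comp_apply, LinearMap.comp_apply, LinearMap.comp_apply,
        show Coalgebra.comul (R := ℂ) (e i j) = comulOne i j from comul_e i j,
        show Coalgebra.counit (R := ℂ) (e i j) = _ from counit_e i j]
      simp only [comulOne, map_add, map_sum, map_smul, LinearMap.rTensor_tmul, linExt_e, linExt_E,
        LinearMap.mul'_apply, e_mul_e, E_mul_E]
      have hi : ∀ x : ZMod n, -x = i - x ↔ i = 0 := fun x => by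
        constructor
        · intro h; linear_combination h * (-1)
        · rintro rfl; ring
      have hj : ∀ x : ZMod n, -x = j - x ↔ j = 0 := fun x => by
        constructor
        · intro h; linear_combination h * (-1)
        · rintro rfl; ring
      simp only [hi, hj, left_eq_add]
      have hn : (n : ℂ) ≠ 0 := by exact_mod_cast NeZero.ne n
      by_cases hj0 : j = 0
      · by_cases hi0 : i = 0
        · subst hj0 hi0
          simp only [and_self, if_true, Algebra.linearMap_apply, map_one, one_eq, zero_mul,
            AddChar.map_zero_eq_one, one_smul, add_zero]
          congr 1
          · rw [← Equiv.sum_comp (Equiv.neg (ZMod n))]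
            refine Finset.sum_congr rfl fun x _ => ?_
            rw [← Equiv.sum_comp (Equiv.neg (ZMod n))]
            simp
          · simp [hn, ← Nat.cast_smul_eq_nsmul ℂ, smul_smul, ZMod.card]
        · subst hj0
          have h1 : ∀ y : ZMod n, ∑ x, (ZMod.stdAddChar (i * (x - y)) : ℂ) = 0 := fun y => by
            rw [Fintype.sum_equiv (Equiv.subRight y) _ (fun x => (ZMod.stdAddChar (x * i) : ℂ))
              (fun x => by simp [mul_comm]), sum_char, if_neg hi0]
          have h2 : ∀ y : ZMod n, ∑ x, (ZMod.stdAddChar (i * (y - x)) : ℂ) = 0 := fun y => by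
            rw [Fintype.sum_equiv (Equiv.subLeft y) _ (fun x => (ZMod.stdAddChar (x * i) : ℂ))
              (fun x => by simp [mul_comm]), sum_char, if_neg hi0]
          simp only [hi0, false_and, if_false, Finset.sum_const_zero, zero_add, if_true, map_zero]
          rw [Finset.sum_comm]
          simp only [← Finset.sum_smul, h1, h2, zero_smul, Finset.sum_const_zero, smul_zero]
      · simp [hj0]
    · rw [LinearMap.comp_apply, LinearMap.comp_apply, LinearMap.comp_apply,
        show Coalgebra.comul (R := ℂ) (E i j) = comulMat i j from comul_E i j,
        show Coalgebra.counit (R := ℂ) (E i j) = _ from counit_E i j]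
      simp [comulMat, linExt_e, linExt_E, e_mul_E, E_mul_e]
  mul_antipode_lTensor_comul := by
    refine hom_ext (fun i j => ?_) (fun i j => ?_)
    · rw [LinearMap.comp_apply, LinearMap.comp_apply, LinearMap.comp_apply,
        show Coalgebra.comul (R := ℂ) (e i j) = comulOne i j from comul_e i j,
        show Coalgebra.counit (R := ℂ) (e i j) = _ from counit_e i j]
      simp only [comulOne, map_add, map_sum, map_smul, LinearMap.lTensor_tmul, linExt_e, linExt_E,
        LinearMap.mul'_apply, e_mul_e, E_mul_E]
      have hi : ∀ x : ZMod n, x = -(i - x) ↔ i = 0 := fun x => by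
        constructor
        · intro h; linear_combination h
        · rintro rfl; ring
      have hj : ∀ x : ZMod n, x = -(j - x) ↔ j = 0 := fun x => by
        constructor
        · intro h; linear_combination h
        · rintro rfl; ring
      simp only [hi, hj, left_eq_add]
      have hn : (n : ℂ) ≠ 0 := by exact_mod_cast NeZero.ne n
      by_cases hj0 : j = 0
      · by_cases hi0 : i = 0
        · subst hj0 hi0
          simp only [and_self, if_true, Algebra.linearMap_apply, map_one, one_eq, zero_mul,
            AddChar.map_zero_eq_one, one_smul, add_zero]
          congr 1
          · simp [hn, ← Nat.cast_smul_eq_nsmul ℂ, ← Finset.smul_sum, smul_smul, ZMod.card]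
        · subst hj0
          have h1 : ∀ y : ZMod n, ∑ x, (ZMod.stdAddChar (i * (x - y)) : ℂ) = 0 := fun y => by
            rw [Fintype.sum_equiv (Equiv.subRight y) _ (fun x => (ZMod.stdAddChar (x * i) : ℂ))
              (fun x => by simp [mul_comm]), sum_char, if_neg hi0]
          have h2 : ∀ y : ZMod n, ∑ x, (ZMod.stdAddChar (i * (y - x)) : ℂ) = 0 := fun y => by
            rw [Fintype.sum_equiv (Equiv.subLeft y) _ (fun x => (ZMod.stdAddChar (x * i) : ℂ))
              (fun x => by simp [mul_comm]), sum_char, if_neg hi0]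
          simp only [hi0, false_and, if_false, Finset.sum_const_zero, zero_add, if_true, map_zero]
          simp only [← Finset.sum_smul, h1, h2, zero_smul, Finset.sum_const_zero, smul_zero]
      · simp [hj0]
    · rw [LinearMap.comp_apply, LinearMap.comp_apply, LinearMap.comp_apply,
        show Coalgebra.comul (R := ℂ) (E i j) = comulMat i j from comul_E i j,
        show Coalgebra.counit (R := ℂ) (E i j) = _ from counit_E i j]
      simp [comulMat, linExt_e, linExt_E, e_mul_E, E_mul_e]

/-- The comultiplication preserves the involution. -/
lemma comul_star (x : FunAlg n) :
    Coalgebra.comul (R := ℂ) (star x) = star (Coalgebra.comul (R := ℂ) x) := by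
  have hs : ∀ a : ZMod n, star (ZMod.stdAddChar a : ℂ) = ZMod.stdAddChar (-a) :=
    fun a => (AddChar.map_neg_eq_conj _ a).symm
  have he : ∀ i j : ZMod n, Coalgebra.comul (R := ℂ) (star (e i j)) =
      star (Coalgebra.comul (R := ℂ) (e i j)) := by
    intro i j
    rw [star_e, show Coalgebra.comul (R := ℂ) (e i j) = comulOne i j from comul_e i j]
    simp only [comulOne, star_add, star_sum, star_smul, TensorProduct.star_tmul, star_e, star_E, hs]
    congr 2
    · simp
    · rw [Finset.sum_comm]
      simp [← mul_neg]
  have hE : ∀ i j : ZMod n, Coalgebra.comul (R := ℂ) (star (E i j)) =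
      star (Coalgebra.comul (R := ℂ) (E i j)) := by
    intro i j
    rw [star_E, show Coalgebra.comul (R := ℂ) (E i j) = comulMat i j from comul_E i j,
      show Coalgebra.comul (R := ℂ) (E j i) = comulMat j i from comul_E j i]
    simp [comulMat, star_add, star_sum, star_smul, TensorProduct.star_tmul, star_e, star_E, hs,
      ← mul_neg]
  rw [eq_sum x]
  simp only [star_sum, star_add, star_smul, map_sum, map_add, map_smul, he, hE]


/-- The Haar state: `x ↦ (∑ x_{(i,j)} + n Tr(a)) / (2n²)` for `x = ∑ x_{(i,j)} e_{(i,j)} + a`. -/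
def haarState (n : ℕ) [NeZero n] : FunAlg n →ₗ[ℂ] ℂ :=
  (1 / (2 * n ^ 2) : ℂ) • ((∑ i, ∑ j, eDual i j) + (n : ℂ) • ∑ i, EDual i i)

/-- The driving state `⅛(e^{(0,1)} + e^{(1,0)} + e^{(-1,0)} + e^{(0,-1)}) + (1/2n) ∑ E^{p,q}`. -/
def walkState (n : ℕ) [NeZero n] : FunAlg n →ₗ[ℂ] ℂ :=
  (1 / 8 : ℂ) • (eDual 0 1 + eDual 1 0 + eDual (-1) 0 + eDual 0 (-1)) +
    (1 / (2 * n) : ℂ) • ∑ p, ∑ q, EDual p q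

lemma eDual_star_mul_self (a : FunAlg n) (i j : ZMod n) :
    eDual i j (star a * a) = (Complex.normSq (eDual i j a) : ℂ) :=
  (Complex.normSq_eq_conj_mul_self (z := a.1 (i, j))).symm

lemma EDual_star_mul_self (a : FunAlg n) (i j : ZMod n) :
    EDual i j (star a * a) = ∑ l, star (EDual l i a) * EDual l j a :=
  Matrix.mul_apply

lemma sum_EDual_star_mul_self (a : FunAlg n) :
    ∑ i, EDual i i (star a * a) = ((∑ i, ∑ l, Complex.normSq (EDual l i a) : ℝ) : ℂ) := by
  simp only [EDual_star_mul_self, Complex.ofReal_sum]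
  exact Finset.sum_congr rfl fun i _ => Finset.sum_congr rfl fun l _ =>
    (Complex.normSq_eq_conj_mul_self).symm

lemma sum2_EDual_star_mul_self (a : FunAlg n) :
    ∑ i, ∑ j, EDual i j (star a * a) =
      ((∑ l, Complex.normSq (∑ j, EDual l j a) : ℝ) : ℂ) := by
  simp only [EDual_star_mul_self, Complex.ofReal_sum, Complex.normSq_eq_conj_mul_self, map_sum,
    Finset.sum_mul, Finset.mul_sum]
  trans ∑ i, ∑ l, ∑ j, star (EDual l i a) * EDual l j a
  · exact Finset.sum_congr rfl fun i _ => Finset.sum_comm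
  · rw [Finset.sum_comm]
    refine Finset.sum_congr rfl fun l _ => ?_
    first | rfl | (rw [Finset.sum_comm]; rfl)

lemma eDual_one (i j : ZMod n) : eDual i j (1 : FunAlg n) = 1 := rfl

lemma EDual_one (i j : ZMod n) : EDual i j (1 : FunAlg n) = if i = j then 1 else 0 :=
  Matrix.one_apply

lemma ofReal_state {z : ℂ} {r : ℝ} (h : z = r) (hr : 0 ≤ r) : 0 ≤ z.re ∧ z.im = 0 := by
  subst h; exact ⟨by simpa using hr, by simp⟩

lemma isState_walkState : FiniteQuantumGroup.IsState (walkState n) := by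
  have hn : (n : ℂ) ≠ 0 := by exact_mod_cast NeZero.ne n
  refine ⟨fun a => ?_, ?_⟩
  · refine ofReal_state (r := 1 / 8 * (Complex.normSq (eDual 0 1 a) + Complex.normSq (eDual 1 0 a) +
      Complex.normSq (eDual (-1) 0 a) + Complex.normSq (eDual 0 (-1) a)) +
      1 / (2 * n) * ∑ l, Complex.normSq (∑ j, EDual l j a)) ?_ ?_
    · simp only [walkState, LinearMap.add_apply, LinearMap.smul_apply, LinearMap.sum_apply,
        eDual_star_mul_self, sum2_EDual_star_mul_self, smul_eq_mul]
      push_cast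
      rfl
    · have h1 : ∀ z, 0 ≤ Complex.normSq z := Complex.normSq_nonneg
      have h2 : 0 ≤ ∑ l, Complex.normSq (∑ j, EDual l j a) := Finset.sum_nonneg fun _ _ => h1 _
      have := h1 (eDual 0 1 a)
      have := h1 (eDual 1 0 a)
      have := h1 (eDual (-1) 0 a)
      have := h1 (eDual 0 (-1) a)
      positivity
  · simp only [walkState, LinearMap.add_apply, LinearMap.smul_apply, LinearMap.sum_apply,
      eDual_one, EDual_one, smul_eq_mul]
    simp
    field_simp
    norm_num

lemma sum_char_smul {M : Type*} [AddCommGroup M] [Module ℂ M] (a : ZMod n) (c : ℂ)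
    (f : ZMod n → M) :
    ∑ x, ∑ y, (ZMod.stdAddChar (x * a) : ℂ) • c • f y =
      (if a = 0 then (n : ℂ) * c else 0) • ∑ y, f y := by
  simp only [← Finset.smul_sum]
  rw [← Finset.sum_smul, sum_char, smul_smul, ite_mul, zero_mul]

lemma isHaarState_haarState : FiniteQuantumGroup.IsHaarState (haarState n) := by
  have hn : (n : ℂ) ≠ 0 := by exact_mod_cast NeZero.ne n
  have he : ∀ i j : ZMod n, haarState n (e i j) = 1 / (2 * n ^ 2) := fun i j => by
    simp only [haarState, LinearMap.add_apply, LinearMap.smul_apply, LinearMap.sum_apply,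
      eDual_e, EDual_e, smul_eq_mul, sum_ite2]
    simp
  have hE : ∀ i j : ZMod n, haarState n (E i j) = if i = j then 1 / (2 * n : ℂ) else 0 :=
    fun i j => by
    simp only [haarState, LinearMap.add_apply, LinearMap.smul_apply, LinearMap.sum_apply,
      eDual_E, EDual_E, smul_eq_mul]
    by_cases h : i = j
    · subst h
      simp
      field_simp
    · have : ∀ x, ¬ (i = x ∧ j = x) := fun x hx => h (hx.1.trans hx.2.symm)
      simp [h, this]
  have hone : ∀ c : ℂ, c • (1 : FunAlg n) = (∑ i, ∑ j, c • e i j) + ∑ i, c • E i i := by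
    intro c; rw [one_eq, smul_add]; simp only [Finset.smul_sum]
  refine ⟨⟨fun a => ?_, ?_⟩, fun a => ⟨?_, ?_⟩⟩
  · refine ofReal_state (r := 1 / (2 * n ^ 2) * ((∑ i, ∑ j, Complex.normSq (eDual i j a)) +
      n * ∑ i, ∑ l, Complex.normSq (EDual l i a))) ?_ ?_
    · simp only [haarState, LinearMap.add_apply, LinearMap.smul_apply, LinearMap.sum_apply,
        eDual_star_mul_self, sum_EDual_star_mul_self, smul_eq_mul]
      push_cast
      rfl
    · have h1 : ∀ z, 0 ≤ Complex.normSq z := Complex.normSq_nonneg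
      have h2 : 0 ≤ ∑ i, ∑ j, Complex.normSq (eDual i j a) :=
        Finset.sum_nonneg fun _ _ => Finset.sum_nonneg fun _ _ => h1 _
      have h3 : 0 ≤ ∑ i, ∑ l, Complex.normSq (EDual l i a) :=
        Finset.sum_nonneg fun _ _ => Finset.sum_nonneg fun _ _ => h1 _
      positivity
  · simp only [haarState, LinearMap.add_apply, LinearMap.smul_apply, LinearMap.sum_apply,
      eDual_one, EDual_one, smul_eq_mul]
    simp [ZMod.card]
    field_simp
    norm_num
  · have h : (TensorProduct.rid ℂ (FunAlg n)).toLinearMap ∘ₗ (haarState n).lTensor (FunAlg n) ∘ₗ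
        Coalgebra.comul = (haarState n).smulRight (1 : FunAlg n) := by
      refine hom_ext (fun i j => ?_) (fun i j => ?_)
      · simp only [LinearMap.comp_apply, comul_e, comulOne, map_add, map_sum, map_smul,
          LinearMap.lTensor_tmul, LinearEquiv.coe_coe, TensorProduct.rid_tmul, he, hE,
          LinearMap.smulRight_apply, hone]
        congr 1
        simp only [add_left_inj, ite_smul, zero_smul, smul_ite, smul_zero, Finset.sum_ite_eq,
          Finset.mem_univ, if_true, sub_self, mul_zero, AddChar.map_zero_eq_one, one_smul,
          Finset.smul_sum, smul_smul]
        refine Finset.sum_congr rfl fun x _ => ?_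
        congr 1
        field_simp
      · simp only [LinearMap.comp_apply, comul_E, comulMat, map_add, map_sum, map_smul,
          LinearMap.lTensor_tmul, LinearEquiv.coe_coe, TensorProduct.rid_tmul, he, hE,
          LinearMap.smulRight_apply, hone]
        by_cases hij : i = j
        · subst hij
          simp only [sum_char_smul, sub_self, mul_zero, AddChar.map_zero_eq_one, one_smul, if_true]
          have hc : (n : ℂ) * (1 / (2 * n ^ 2)) = 1 / (2 * n) := by field_simp
          have hS : ∀ f : ZMod n → FunAlg n, ∑ _x : ZMod n, ∑ y, (1 / (2 * n ^ 2) : ℂ) • f y =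
              ∑ y, (1 / (2 * n) : ℂ) • f y := by
            intro f
            simp only [← Finset.smul_sum, Finset.sum_const, Finset.card_univ, ZMod.card,
              ← Nat.cast_smul_eq_nsmul ℂ, smul_smul, mul_comm _ (n : ℂ), hc]
          rw [hS fun y => E (i - y) (i - y)]
          congr 1
          · rw [← Equiv.sum_comp (Equiv.neg (ZMod n))]
            refine Finset.sum_congr rfl fun x _ => ?_
            rw [← Equiv.sum_comp (Equiv.neg (ZMod n))]
            simp
          · rw [← Equiv.sum_comp (Equiv.subLeft i)]
            simp
        · simp [sum_char_smul, hij, sub_eq_zero, Ne.symm hij]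
    exact LinearMap.congr_fun h a
  · have h : (TensorProduct.lid ℂ (FunAlg n)).toLinearMap ∘ₗ (haarState n).rTensor (FunAlg n) ∘ₗ
        Coalgebra.comul = (haarState n).smulRight (1 : FunAlg n) := by
      refine hom_ext (fun i j => ?_) (fun i j => ?_)
      · simp only [LinearMap.comp_apply, comul_e, comulOne, map_add, map_sum, map_smul,
          LinearMap.rTensor_tmul, LinearEquiv.coe_coe, TensorProduct.lid_tmul, he, hE,
          LinearMap.smulRight_apply, hone]
        congr 1
        · rw [← Equiv.sum_comp (Equiv.subLeft i)]
          refine Finset.sum_congr rfl fun x _ => ?_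
          rw [← Equiv.sum_comp (Equiv.subLeft j)]
          simp
        · simp only [ite_smul, zero_smul, smul_ite, smul_zero, Finset.sum_ite_eq,
            Finset.mem_univ, if_true, sub_self, mul_zero, AddChar.map_zero_eq_one, one_smul,
            Finset.smul_sum, smul_smul]
          conv_rhs => rw [← Equiv.sum_comp (Equiv.addRight j)]
          refine Finset.sum_congr rfl fun x _ => ?_
          congr 1
          field_simp
      · simp only [LinearMap.comp_apply, comul_E, comulMat, map_add, map_sum, map_smul,
          LinearMap.rTensor_tmul, LinearEquiv.coe_coe, TensorProduct.lid_tmul, he, hE,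
          LinearMap.smulRight_apply, hone]
        by_cases hij : i = j
        · subst hij
          simp only [sum_char_smul, sub_self, mul_zero, AddChar.map_zero_eq_one, one_smul, if_true]
          have hc : (n : ℂ) * (1 / (2 * n ^ 2)) = 1 / (2 * n) := by field_simp
          have hS : ∀ f : ZMod n → FunAlg n, ∑ _x : ZMod n, ∑ y, (1 / (2 * n ^ 2) : ℂ) • f y =
              ∑ y, (1 / (2 * n) : ℂ) • f y := by
            intro f
            simp only [← Finset.smul_sum, Finset.sum_const, Finset.card_univ, ZMod.card,
              ← Nat.cast_smul_eq_nsmul ℂ, smul_smul, mul_comm _ (n : ℂ), hc]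
          rw [hS fun y => E (i - y) (i - y)]
          rw [add_comm]
          congr 1
          rw [← Equiv.sum_comp (Equiv.subLeft i)]
          simp
        · simp [sum_char_smul, hij, sub_eq_zero, Ne.symm hij]
    exact LinearMap.congr_fun h a

end

end Sekine

/-! Convolution by `walkState` is diagonalised by the Fourier transform on ℤ/n × ℤ/n. A functional
with Fourier coefficients F(s,t) on the commutative summand and Toeplitz symbol b on the matrix
summand is sent to one of the same kind. For t ≠ 0 the coefficient F(s,t) is multiplied by (cos s +
cos t)/4, of modulus at most 1/2; here cos s stands for `cosChar s`. The pair (F(s,0), b(s)) is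
multiplied by the symmetric matrix with diagonal (1 + cos s)/4 and off-diagonal 1/2, whose
eigenvectors (1,1) and (1,-1) have eigenvalues (3 + cos s)/4 (`eigPos`) and (cos s - 1)/4
(`eigNeg`). Starting from the counit, F = 1 and b = 0, this gives all powers in closed form
(`convPow_walkState`). The Haar state is the fixed part at s = t = 0, so the distance is governed by
`eigPos` at s = ±1, which is 1 - sin²(π/n)/2, roughly 1 - π²/(2n²).

Upper bound: Cauchy–Schwarz and Plancherel on the unitary 2p - 1 bound the squared distance by half
the sum of the squared coefficients (`tvDist_sq_le`). The powers of `eigPos` contribute at most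
e^{-απ²/2} (`exp_mul_sum_pow_le`), everything else is of order n² 4^{-k} and relatively negligible
(`exp_mul_quarter_pow_le`).

Lower bound: testing against (1 + cos)/2, which has values in [0,1], detects half of `eigPos 1 ^ k`,
and passing to positive parts turns this test function into a projection
(`half_eigPos_pow_le_tvDist`). The inequality e^{-x²/2} ≤ (1 + cos² x)/2 at x = π/n then gives the
exponential.

No cut-off: both bounds are functions of k/n², so a distance near 1 forces k < n², while the
distance at 4n² steps is still bounded below. -/

namespace Sekine

noncomputable section

/-! ### Fourier description of the convolution powers -/

variable {n : ℕ}

/-- The real part of the standard character of `ℤ/n`. -/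
def cosChar (s : ZMod n) : ℝ := Real.cos (2 * Real.pi * s.val / n)

lemma cosChar_zero : cosChar (0 : ZMod n) = 1 := by simp [cosChar]

lemma abs_cosChar_le (s : ZMod n) : |cosChar s| ≤ 1 := Real.abs_cos_le_one _

variable [NeZero n]

lemma stdAddChar_re (s : ZMod n) : (ZMod.stdAddChar s : ℂ).re = cosChar s := by
  rw [ZMod.stdAddChar_apply, ZMod.toCircle_apply, cosChar,
    show 2 * (Real.pi : ℂ) * Complex.I * s.val / n =
      ((2 * Real.pi * s.val / n : ℝ) : ℂ) * Complex.I by push_cast; ring,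
    Complex.exp_ofReal_mul_I_re]

lemma stdAddChar_add_neg (s : ZMod n) :
    (ZMod.stdAddChar s : ℂ) + ZMod.stdAddChar (-s) = 2 * (cosChar s : ℂ) := by
  rw [AddChar.map_neg_eq_conj, Complex.add_conj, stdAddChar_re]
  push_cast
  rfl

lemma cosChar_neg (s : ZMod n) : cosChar (-s) = cosChar s := by
  rw [← stdAddChar_re, ← stdAddChar_re, AddChar.map_neg_eq_conj, Complex.conj_re]

/-- The functional with Fourier coefficients `F` on the commutative summand and the Toeplitz
matrix of symbol `b` on the matrix summand. -/
def fourierFun (F : ZMod n → ZMod n → ℂ) (b : ZMod n → ℂ) : FunAlg n →ₗ[ℂ] ℂ :=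
  linExt (fun i j => 1 / (n : ℂ) ^ 2 * ∑ s, ∑ t, ZMod.stdAddChar (s * i + t * j) * F s t)
    (fun i j => 1 / (n : ℂ) * b (i - j))

lemma fourierFun_e (F : ZMod n → ZMod n → ℂ) (b : ZMod n → ℂ) (i j : ZMod n) :
    fourierFun F b (e i j) =
      1 / (n : ℂ) ^ 2 * ∑ s, ∑ t, ZMod.stdAddChar (s * i + t * j) * F s t :=
  linExt_e _ _ _ _

lemma fourierFun_E (F : ZMod n → ZMod n → ℂ) (b : ZMod n → ℂ) (i j : ZMod n) :
    fourierFun F b (E i j) = 1 / (n : ℂ) * b (i - j) :=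
  linExt_E _ _ _ _

lemma sum_walkState_e_mul (f : ZMod n → ZMod n → ℂ) :
    ∑ l, ∑ m, walkState n (e l m) * f l m =
      1 / 8 * (f 0 1 + f 1 0 + f (-1) 0 + f 0 (-1)) := by
  have h : ∀ l m : ZMod n, walkState n (e l m) = 1 / 8 * ((if 0 = l ∧ 1 = m then 1 else 0) +
      (if 1 = l ∧ 0 = m then 1 else 0) + (if -1 = l ∧ 0 = m then 1 else 0) +
      (if 0 = l ∧ -1 = m then 1 else 0)) := by
    intro l m
    simp only [walkState, LinearMap.add_apply, LinearMap.smul_apply, LinearMap.sum_apply,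
      eDual_e, EDual_e, smul_eq_mul, Finset.sum_const_zero, mul_zero, add_zero,
      eq_comm (a := l), eq_comm (b := m)]
  simp only [h, mul_assoc, add_mul, ite_mul, one_mul, zero_mul, ← Finset.mul_sum,
    Finset.sum_add_distrib, sum_ite2]

lemma walkState_E (i j : ZMod n) : walkState n (E i j) = 1 / (2 * n) := by
  simp only [walkState, LinearMap.add_apply, LinearMap.smul_apply, LinearMap.sum_apply,
    eDual_E, EDual_E, smul_eq_mul, sum_ite2]
  simp

lemma sum_sum_sub (f : ZMod n → ℂ) : ∑ l, ∑ m, f (l - m) = n * ∑ d, f d := by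
  have h : ∀ l : ZMod n, ∑ m, f (l - m) = ∑ d, f d := fun l => Equiv.sum_comp (Equiv.subLeft l) f
  simp [h, ZMod.card]

/-- Summing over m kills every t ≠ 0 and summing over l selects s = d. This is why the matrix
summand interacts only with the frequencies t = 0. -/
lemma sum_char_mul_fourier (d : ZMod n) (F : ZMod n → ZMod n → ℂ) :
    ∑ l, ∑ m, ZMod.stdAddChar (l * -d) *
        (1 / (n : ℂ) ^ 2 * ∑ s, ∑ t, ZMod.stdAddChar (s * l + t * m) * F s t) = F d 0 := by
  have hn : (n : ℂ) ≠ 0 := by exact_mod_cast NeZero.ne n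
  have h : ∀ l m : ZMod n, ZMod.stdAddChar (l * -d) *
        (1 / (n : ℂ) ^ 2 * ∑ s, ∑ t, ZMod.stdAddChar (s * l + t * m) * F s t) =
      ∑ s, ∑ t, 1 / (n : ℂ) ^ 2 * F s t *
        (ZMod.stdAddChar (l * (s - d)) * ZMod.stdAddChar (m * t)) := by
    intro l m
    simp only [Finset.mul_sum]
    refine Finset.sum_congr rfl fun s _ => Finset.sum_congr rfl fun t _ => ?_
    have : (ZMod.stdAddChar (l * -d) : ℂ) * ZMod.stdAddChar (s * l + t * m) =
        ZMod.stdAddChar (l * (s - d)) * ZMod.stdAddChar (m * t) := by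
      rw [← AddChar.map_add_eq_mul, ← AddChar.map_add_eq_mul]
      congr 1
      ring
    linear_combination (1 / (n : ℂ) ^ 2 * F s t) * this
  simp only [h]
  have h1 : ∀ l : ZMod n, ∑ m : ZMod n, ∑ s, ∑ t, 1 / (n : ℂ) ^ 2 * F s t *
        (ZMod.stdAddChar (l * (s - d)) * ZMod.stdAddChar (m * t)) =
      ∑ s, 1 / (n : ℂ) * F s 0 * ZMod.stdAddChar (l * (s - d)) := by
    intro l
    rw [Finset.sum_comm]
    refine Finset.sum_congr rfl fun s _ => ?_
    rw [Finset.sum_comm]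
    simp only [← Finset.mul_sum, sum_char, mul_ite, mul_zero, Finset.sum_ite_eq',
      Finset.mem_univ, if_true]
    field_simp
  simp only [h1]
  rw [Finset.sum_comm]
  simp only [← Finset.mul_sum, sum_char, mul_ite, mul_zero, sub_eq_zero, Finset.sum_ite_eq',
      Finset.mem_univ, if_true]
  field_simp

/-- The four point masses pair up into cosines. The constant matrix part 1/(2n) exchanges the
summands: E ⊗ E in Δ(e) feeds b into the frequencies t = 0, and E ⊗ e in Δ(E) feeds F(·,0) back into
b. -/
lemma walkState_conv_fourierFun (F : ZMod n → ZMod n → ℂ) (b : ZMod n → ℂ) :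
    LinearMap.mul' ℂ ℂ ∘ₗ TensorProduct.map (walkState n) (fourierFun F b) ∘ₗ
        Coalgebra.comul =
      fourierFun
        (fun s t => (cosChar s + cosChar t) / 4 * F s t + if t = 0 then b s / 2 else 0)
        (fun d => (1 + cosChar d) / 4 * b d + F d 0 / 2) := by
  have hn : (n : ℂ) ≠ 0 := by exact_mod_cast NeZero.ne n
  refine hom_ext (fun i j => ?_) (fun i j => ?_)
  · simp only [LinearMap.comp_apply, comul_e, comulOne, map_add, map_sum, map_smul,
      TensorProduct.map_tmul, LinearMap.mul'_apply, sum_walkState_e_mul, walkState_E,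
      fourierFun_e, fourierFun_E, smul_eq_mul]
    have h1 : ∑ l : ZMod n, ∑ m, ZMod.stdAddChar (i * (l - m)) *
        (1 / (2 * (n : ℂ)) * (1 / (n : ℂ) * b (l + j - (m + j)))) =
        1 / n * ∑ s, ZMod.stdAddChar (s * i) * (b s / 2) := by
      simp only [add_sub_add_right_eq_sub]
      rw [sum_sum_sub fun d => ZMod.stdAddChar (i * d) * (1 / (2 * (n : ℂ)) * (1 / (n : ℂ) * b d)),
        Finset.mul_sum, Finset.mul_sum]
      refine Finset.sum_congr rfl fun s _ => ?_
      rw [mul_comm i s]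
      field_simp
    rw [h1]
    simp only [mul_add, Finset.sum_add_distrib, mul_ite, mul_zero, Finset.sum_ite_eq',
      Finset.mem_univ, if_true, zero_mul, add_zero]
    congr 1
    · simp only [Finset.mul_sum, ← Finset.sum_add_distrib]
      refine Finset.sum_congr rfl fun s _ => Finset.sum_congr rfl fun t _ => ?_
      have hs := stdAddChar_add_neg s
      have ht := stdAddChar_add_neg t
      have e1 : (ZMod.stdAddChar (s * (i - 0) + t * (j - 1)) : ℂ) =
        ZMod.stdAddChar (s * i + t * j) * ZMod.stdAddChar (-t) := by
        rw [← AddChar.map_add_eq_mul]; congr 1; ring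
      have e2 : (ZMod.stdAddChar (s * (i - 1) + t * (j - 0)) : ℂ) =
        ZMod.stdAddChar (s * i + t * j) * ZMod.stdAddChar (-s) := by
        rw [← AddChar.map_add_eq_mul]; congr 1; ring
      have e3 : (ZMod.stdAddChar (s * (i - -1) + t * (j - 0)) : ℂ) =
        ZMod.stdAddChar (s * i + t * j) * ZMod.stdAddChar s := by
        rw [← AddChar.map_add_eq_mul]; congr 1; ring
      have e4 : (ZMod.stdAddChar (s * (i - 0) + t * (j - -1)) : ℂ) =
        ZMod.stdAddChar (s * i + t * j) * ZMod.stdAddChar t := by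
        rw [← AddChar.map_add_eq_mul]; congr 1; ring
      simp only [mul_sub, mul_zero, mul_one, mul_neg] at e1 e2 e3 e4 ⊢
      rw [e1, e2, e3, e4]
      linear_combination (1 / 8 * (1 / (n : ℂ) ^ 2) * ZMod.stdAddChar (s * i + t * j) * F s t) *
        (hs + ht)
    · field_simp
  · simp only [LinearMap.comp_apply, comul_E, comulMat, map_add, map_sum, map_smul,
      TensorProduct.map_tmul, LinearMap.mul'_apply, walkState_E,
      fourierFun_e, fourierFun_E, smul_eq_mul, sub_sub_sub_cancel_right]
    rw [mul_add]
    congr 1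
    · have h := sum_walkState_e_mul fun l m : ZMod n =>
        ZMod.stdAddChar (-l * (i - j)) * (1 / (n : ℂ) * b (i - j))
      rw [← Equiv.sum_comp (Equiv.neg (ZMod n))] at h
      simp_rw [← Equiv.sum_comp (Equiv.neg (ZMod n)) (fun m => walkState n (e (Equiv.neg _ _) m) *
        (ZMod.stdAddChar (-(Equiv.neg _ _ : ZMod n) * (i - j)) * (1 / (n : ℂ) * b (i - j))))] at h
      simp only [Equiv.neg_apply, neg_neg, neg_zero, zero_mul, one_mul, AddChar.map_zero_eq_one,
        neg_one_mul] at h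
      have hd := stdAddChar_add_neg (i - j)
      trans 1 / 8 * (1 / ↑n * b (i - j) + ZMod.stdAddChar (-(i - j)) * (1 / ↑n * b (i - j)) +
          ZMod.stdAddChar (i - j) * (1 / ↑n * b (i - j)) + 1 / ↑n * b (i - j))
      · rw [← h]
        exact Finset.sum_congr rfl fun l _ => Finset.sum_congr rfl fun m _ => mul_left_comm _ _ _
      · linear_combination (1 / 8 * (1 / (n : ℂ) * b (i - j))) * hd
    · have h := sum_char_mul_fourier (i - j) F
      rw [neg_sub] at h
      rw [← h]
      simp only [Finset.mul_sum, Finset.sum_div]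
      refine Finset.sum_congr rfl fun l _ => Finset.sum_congr rfl fun m _ =>
        Finset.sum_congr rfl fun s _ => Finset.sum_congr rfl fun t _ => ?_
      field_simp

/-- The larger eigenvalue of the walk at frequency `s`. -/
def eigPos (s : ZMod n) : ℝ := (3 + cosChar s) / 4

/-- The smaller eigenvalue of the walk at frequency `s`. -/
def eigNeg (s : ZMod n) : ℝ := (cosChar s - 1) / 4

/-- The Fourier coefficients of the `k`-th convolution power on the commutative summand. -/
def coeffComm (k : ℕ) (s t : ZMod n) : ℝ :=
  if t = 0 then (eigPos s ^ k + eigNeg s ^ k) / 2 else ((cosChar s + cosChar t) / 4) ^ k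

/-- The Toeplitz symbol of the `k`-th convolution power on the matrix summand. -/
def coeffMat (k : ℕ) (s : ZMod n) : ℝ := (eigPos s ^ k - eigNeg s ^ k) / 2

/-- The counit has (F(s,0), b(s)) = (1,0), half the sum of the eigenvectors (1,1) and (1,-1) of the
2 × 2 block at s; hence the half sum and half difference of powers. -/
lemma convPow_walkState (k : ℕ) :
    FiniteQuantumGroup.convPow (walkState n) k =
      fourierFun (fun s t => (coeffComm k s t : ℂ)) (fun s => (coeffMat k s : ℂ)) := by
  induction k with
  | zero =>
    have hn : (n : ℂ) ≠ 0 := by exact_mod_cast NeZero.ne n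
    have h0 : FiniteQuantumGroup.convPow (walkState n) 0 = Coalgebra.counit := by
      unfold FiniteQuantumGroup.convPow
      rw [pow_zero]
      rfl
    rw [h0]
    refine hom_ext (fun i j => ?_) (fun i j => ?_)
    · have h : ∀ s t : ZMod n, (coeffComm 0 s t : ℂ) = 1 := by
        intro s t; simp [coeffComm]
      simp only [counit_e, fourierFun_e, h, mul_one, AddChar.map_add_eq_mul]
      simp only [← Finset.mul_sum, ← Finset.sum_mul, sum_char]
      by_cases hi : i = 0 <;> by_cases hj : j = 0 <;> simp [hi, hj]
      field_simp
    · simp [counit_E, fourierFun_E, coeffMat]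
  | succ k ih =>
    rw [FiniteQuantumGroup.convPow_succ, ih, walkState_conv_fourierFun]
    congr 1
    · funext s t
      by_cases ht : t = 0
      · subst ht
        simp only [coeffComm, coeffMat, eigPos, eigNeg, if_true, cosChar_zero]
        push_cast
        ring
      · simp only [coeffComm, if_neg ht]
        push_cast
        ring
    · funext d
      simp only [coeffComm, coeffMat, eigPos, eigNeg, if_true]
      push_cast
      ring

lemma haarState_eq_fourierFun :
    haarState n = fourierFun (fun s t => if s = 0 ∧ t = 0 then 1 / 2 else 0)
      (fun s => if s = 0 then 1 / 2 else 0) := by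
  have hn : (n : ℂ) ≠ 0 := by exact_mod_cast NeZero.ne n
  refine hom_ext (fun i j => ?_) (fun i j => ?_)
  · rw [fourierFun_e]
    simp only [haarState, LinearMap.add_apply, LinearMap.smul_apply, LinearMap.sum_apply,
      eDual_e, EDual_e, smul_eq_mul, sum_ite2]
    simp [ite_and]
  · rw [fourierFun_E]
    simp only [haarState, LinearMap.add_apply, LinearMap.smul_apply, LinearMap.sum_apply,
      eDual_E, EDual_E, smul_eq_mul]
    by_cases h : i = j
    · subst h
      simp
      field_simp
    · have : ∀ x, ¬ (i = x ∧ j = x) := fun x hx => h (hx.1.trans hx.2.symm)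
      simp [h, this, sub_eq_zero]

/-- The Fourier coefficients of `ν^{⋆k} - π` on the commutative summand. -/
def diffComm (k : ℕ) (s t : ZMod n) : ℝ := coeffComm k s t - if s = 0 ∧ t = 0 then 1 / 2 else 0

/-- The Toeplitz symbol of `ν^{⋆k} - π` on the matrix summand. -/
def diffMat (k : ℕ) (s : ZMod n) : ℝ := coeffMat k s - if s = 0 then 1 / 2 else 0

lemma convPow_sub_haarState (k : ℕ) (x : FunAlg n) :
    FiniteQuantumGroup.convPow (walkState n) k x - haarState n x =
      fourierFun (fun s t => (diffComm k s t : ℂ)) (fun s => (diffMat k s : ℂ)) x := by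
  have h : FiniteQuantumGroup.convPow (walkState n) k - haarState n =
      fourierFun (fun s t => (diffComm k s t : ℂ)) (fun s => (diffMat k s : ℂ)) := by
    rw [convPow_walkState, haarState_eq_fourierFun]
    refine hom_ext (fun i j => ?_) (fun i j => ?_)
    · simp only [LinearMap.sub_apply, fourierFun_e, ← mul_sub, ← Finset.sum_sub_distrib, diffComm]
      push_cast
      simp only [apply_ite (Complex.ofReal)]
      push_cast
      rfl
    · simp only [LinearMap.sub_apply, fourierFun_E, ← mul_sub, diffMat]
      push_cast
      simp only [apply_ite (Complex.ofReal)]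
      push_cast
      rfl
  rw [← h, LinearMap.sub_apply]

lemma eigPos_zero (m : ℕ) : eigPos (0 : ZMod m) = 1 := by norm_num [eigPos, cosChar_zero]

/-- Adding the two components projects onto the eigenvector (1,1): `eigNeg` cancels, and at s = 0
the two halves of the Haar state remove the eigenvalue 1. -/
lemma diffComm_add_diffMat {m : ℕ} (k : ℕ) (s : ZMod m) :
    diffComm k s 0 + diffMat k s = if s = 0 then 0 else eigPos s ^ k := by
  by_cases hs : s = 0
  · subst hs; simp [diffComm, diffMat, coeffComm, coeffMat, eigPos_zero]; ring
  · simp [diffComm, diffMat, coeffComm, coeffMat, hs]; ring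

end

end Sekine

/-! ### Real inequalities for the eigenvalues -/

namespace Sekine

/-- The function (1 + cos² x) e^{x²/2} equals 2 at 0 and increases on [0,∞), because 2 sin y cos y ≤
2y|cos y| ≤ y(1 + cos² y). -/
lemma exp_neg_sq_div_two_le {x : ℝ} (hx : 0 ≤ x) :
    Real.exp (-(x ^ 2 / 2)) ≤ (1 + Real.cos x ^ 2) / 2 := by
  let f : ℝ → ℝ := fun x => (1 + Real.cos x ^ 2) * Real.exp (x ^ 2 / 2)
  have hd : ∀ y : ℝ, HasDerivAt f ((y * (1 + Real.cos y ^ 2) - 2 * Real.sin y * Real.cos y) *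
      Real.exp (y ^ 2 / 2)) y := by
    intro y
    have h1 := (((Real.hasDerivAt_cos y).pow 2).const_add 1).mul
      (((hasDerivAt_id y).pow 2).div_const 2).exp
    refine h1.congr_deriv ?_
    simp
    ring
  have hm : MonotoneOn f (Set.Ici 0) := by
    refine monotoneOn_of_deriv_nonneg (convex_Ici 0)
      (fun y _ => (hd y).continuousAt.continuousWithinAt)
      (fun y _ => (hd y).differentiableAt.differentiableWithinAt) fun y hy => ?_
    rw [interior_Ici, Set.mem_Ioi] at hy
    rw [(hd y).deriv]
    refine mul_nonneg (sub_nonneg.2 ?_) (Real.exp_pos _).le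
    have h1 : Real.sin y * Real.cos y ≤ y * |Real.cos y| := by
      refine (le_abs_self _).trans ?_
      rw [abs_mul]
      gcongr
      simpa [abs_of_pos hy] using Real.abs_sin_le_abs (x := y)
    have h2 : 2 * |Real.cos y| ≤ 1 + Real.cos y ^ 2 := by
      nlinarith [sq_nonneg (|Real.cos y| - 1), sq_abs (Real.cos y)]
    nlinarith
  have h := hm (Set.mem_Ici.2 le_rfl) (Set.mem_Ici.2 hx) hx
  simp only [f] at h
  norm_num at h
  rw [Real.exp_neg, inv_le_iff_one_le_mul₀ (Real.exp_pos _)]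
  linarith

/-- A majorant of the contribution of frequency `j` relative to that of frequency `1`. -/
noncomputable def freqBound (j : ℕ) : ℝ := if j = 1 then 1 else Real.exp (29 / 20 - j)

lemma freqBound_nonneg (j : ℕ) : 0 ≤ freqBound j := by
  unfold freqBound; split_ifs <;> positivity

/-- The term 1 plus a geometric series: 1 + e^{-11/20}/(1 - e^{-1}) is about 1.91. -/
lemma sum_freqBound_le (n : ℕ) : ∑ j ∈ Finset.Ico 1 n, freqBound j ≤ 2 := by
  have he : (2.718 : ℝ) < Real.exp 1 := lt_trans (by norm_num) Real.exp_one_gt_d9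
  set r : ℝ := Real.exp (-1) with hr
  have hr0 : 0 < r := Real.exp_pos _
  have hr1 : r ≤ 0.368 := by
    rw [hr, Real.exp_neg, inv_le_comm₀ (Real.exp_pos _) (by norm_num)]
    norm_num at he ⊢
    linarith
  have hC : Real.exp (29 / 20 - 2) ≤ 0.6 := by
    have h1 : Real.exp (29 / 20 - 2) = (Real.exp (11 / 20))⁻¹ := by
      rw [← Real.exp_neg]; norm_num
    have h2 := Real.quadratic_le_exp_of_nonneg (x := 11 / 20) (by norm_num)
    rw [h1, inv_le_comm₀ (Real.exp_pos _) (by norm_num)]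
    norm_num at h2 ⊢
    linarith
  -- The subtracted term makes the induction close: 0.97 (1 - r) ≥ 0.97 · 0.632 > 0.6, and at m = 0
  -- the bound 1.03 exceeds the single term 1.
  have key : ∀ m : ℕ, ∑ j ∈ Finset.Ico 1 (m + 2), freqBound j ≤ 2 - 0.97 * r ^ m := by
    intro m
    induction m with
    | zero => norm_num [freqBound]
    | succ m ih =>
      rw [Finset.sum_Ico_succ_top (by omega)]
      have h : freqBound (m + 2) = Real.exp (29 / 20 - 2) * r ^ m := by
        rw [freqBound, if_neg (by omega), hr, ← Real.exp_nat_mul, ← Real.exp_add]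
        congr 1
        push_cast
        ring
      rw [h, pow_succ]
      have hp : 0 < r ^ m := by positivity
      nlinarith
  rcases n with _ | _ | m
  · simp
  · simp
  · refine (key m).trans ?_
    have hp : 0 < r ^ m := by positivity
    linarith

lemma sq_le_two_mul_two_pow (k : ℕ) : (k : ℝ) ^ 2 ≤ 2 * 2 ^ k := by
  -- The induction starts at 3 because (k + 1)² ≤ 2k² fails at k = 1 and k = 2.
  have h : ∀ m : ℕ, ((m + 3 : ℕ) : ℝ) ^ 2 ≤ 2 * 2 ^ (m + 3) := by
    intro m
    induction m with
    | zero => norm_num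
    | succ m ih =>
      rw [show m + 1 + 3 = (m + 3) + 1 by ring, pow_succ (2 : ℝ) (m + 3)]
      push_cast at ih ⊢
      nlinarith [(Nat.cast_nonneg m : (0 : ℝ) ≤ m)]
  rcases k with _ | _ | _ | m
  · norm_num
  · norm_num
  · norm_num
  · exact h m

lemma pi_sq_lt : Real.pi ^ 2 < 9.9 := by
  have := Real.pi_lt_d4
  have := Real.pi_pos
  nlinarith

/-- For x ≤ π/3 the cubic lower bound for the sine gives sin x ≥ 0.8x, and 0.64 > 1/2. -/
lemma sin_sq_pi_div_ge {n : ℕ} (hn : 3 ≤ n) :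
    Real.pi ^ 2 / 2 ≤ (n : ℝ) ^ 2 * Real.sin (Real.pi / n) ^ 2 := by
  have hn' : (3 : ℝ) ≤ n := by exact_mod_cast hn
  have hn0 : (0 : ℝ) < n := by linarith
  set x := Real.pi / n with hx
  have hx0 : 0 < x := by positivity
  have hx1 : x ^ 2 ≤ 1.1 := by
    have h1 : x ≤ Real.pi / 3 := by rw [hx]; gcongr
    have := pi_sq_lt
    nlinarith [Real.pi_pos]
  have h1 := Real.sin_gt_sub_cube hx0
  have h2 : 0.8 * x ≤ Real.sin x := by nlinarith
  have h3 : (0.8 * x) ^ 2 ≤ Real.sin x ^ 2 := by gcongr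
  have h4 : Real.pi = n * x := by rw [hx]; field_simp
  rw [h4]
  nlinarith [mul_pos (pow_pos hn0 2) (pow_pos hx0 2),
    mul_le_mul_of_nonneg_left h3 (sq_nonneg (n : ℝ))]

/-- Jordan's inequality sin x ≥ 2x/π on [0, π/2]. -/
lemma four_mul_sq_le {n j : ℕ} (hn : 0 < n) (hj : 2 * j ≤ n) :
    4 * (j : ℝ) ^ 2 ≤ (n : ℝ) ^ 2 * Real.sin (Real.pi * j / n) ^ 2 := by
  have hn0 : (0 : ℝ) < n := by exact_mod_cast hn
  have hj' : 2 * (j : ℝ) ≤ n := by exact_mod_cast hj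
  have hpi := Real.pi_pos
  have h := Real.mul_le_sin (x := Real.pi * j / n) (by positivity) (by
    rw [div_le_div_iff₀ hn0 two_pos]; nlinarith)
  have h2 : 2 / Real.pi * (Real.pi * j / n) = 2 * j / n := by field_simp
  rw [h2] at h
  calc 4 * (j : ℝ) ^ 2 = (n : ℝ) ^ 2 * (2 * j / n) ^ 2 := by field_simp; ring
    _ ≤ _ := by gcongr

/-- This is where α > 1/20 and the constant 29/20 originate. For j ≥ 2 the exponent is at most
α(4.95 - 4j²), which is negative, so α may be replaced by 1/20, giving 0.2475 - j²/5. With j² ≥ 5j -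
6 this is at most 1.4475 - j. -/
lemma exp_mul_le_freqBound {n j : ℕ} (hn : 3 ≤ n) (hj1 : 1 ≤ j) (hj : 2 * j ≤ n) {α : ℝ}
    (hα : 1 / 20 < α) :
    Real.exp (α * Real.pi ^ 2 / 2 - α * ((n : ℝ) ^ 2 * Real.sin (Real.pi * j / n) ^ 2)) ≤
      freqBound j := by
  unfold freqBound
  split_ifs with h
  · subst h
    rw [Real.exp_le_one_iff]
    have := sin_sq_pi_div_ge hn
    simp only [Nat.cast_one, mul_one]
    nlinarith
  · have hj2 : (2 : ℝ) ≤ j := by exact_mod_cast (by omega : 2 ≤ j)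
    have h1 := four_mul_sq_le (by omega) hj
    have h2 := pi_sq_lt
    rw [Real.exp_le_exp]
    -- Equivalent to (j - 2)(j - 3) ≥ 0, which holds since j is an integer.
    have h3 : (5 * (j : ℝ) - 6) ≤ j ^ 2 := by
      have : (0 : ℝ) ≤ ((j : ℝ) - 2) * (j - 3) := by
        rcases (show j = 2 ∨ 3 ≤ j by omega) with rfl | h3
        · norm_num
        · have : (3 : ℝ) ≤ j := by exact_mod_cast h3
          exact mul_nonneg (by linarith) (by linarith)
      linarith
    nlinarith

/-- The cosine form of the larger eigenvalue of the walk. -/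
lemma three_add_cos_div_four (n j : ℕ) :
    (3 + Real.cos (2 * Real.pi * j / n)) / 4 = 1 - Real.sin (Real.pi * j / n) ^ 2 / 2 := by
  rw [show 2 * Real.pi * j / n = 2 * (Real.pi * j / n) by ring, Real.cos_two_mul, Real.cos_sq']
  ring

/-- From 1 - x ≤ e^{-x}, the power is at most exp(-α n² sin²(πj/n)). The symmetry j ↦ n - j of the
cosine reduces to 2j ≤ n; keeping both summands on the right avoids splitting the later sum over j
at n/2. -/
lemma exp_mul_pow_le {n j k : ℕ} (hn : 3 ≤ n) (hj1 : 1 ≤ j) (hjn : j < n) {α : ℝ}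
    (hα : 1 / 20 < α) (hk : (k : ℝ) = α * (n : ℝ) ^ 2) :
    Real.exp (α * Real.pi ^ 2 / 2) * ((3 + Real.cos (2 * Real.pi * j / n)) / 4) ^ (2 * k) ≤
      freqBound j + freqBound (n - j) := by
  have hn0 : (0 : ℝ) < n := by exact_mod_cast (by omega : 0 < n)
  have main : ∀ m : ℕ, 1 ≤ m → 2 * m ≤ n → Real.exp (α * Real.pi ^ 2 / 2) *
      ((3 + Real.cos (2 * Real.pi * m / n)) / 4) ^ (2 * k) ≤ freqBound m := by
    intro m hm1 hm
    refine le_trans ?_ (exp_mul_le_freqBound hn hm1 hm hα)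
    rw [three_add_cos_div_four, sub_eq_add_neg (α * Real.pi ^ 2 / 2), Real.exp_add]
    gcongr
    set S := Real.sin (Real.pi * m / n) ^ 2 with hS
    have hS1 : S ≤ 1 := Real.sin_sq_le_one _
    calc (1 - S / 2) ^ (2 * k) ≤ (Real.exp (-(S / 2))) ^ (2 * k) := by
          gcongr
          · linarith
          · have := Real.add_one_le_exp (-(S / 2)); linarith
      _ = _ := by
          rw [← Real.exp_nat_mul]
          congr 1
          push_cast
          rw [hk]
          ring
  rcases le_total (2 * j) n with h | h
  · exact (main j hj1 h).trans (le_add_of_nonneg_right (freqBound_nonneg _))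
  · have hc : Real.cos (2 * Real.pi * j / n) = Real.cos (2 * Real.pi * ((n - j : ℕ) : ℝ) / n) := by
      rw [Nat.cast_sub hjn.le, show 2 * Real.pi * ((n : ℝ) - j) / n =
        2 * Real.pi - 2 * Real.pi * j / n by field_simp, Real.cos_two_pi_sub]
    rw [hc]
    exact (main (n - j) (by omega) (by omega)).trans (le_add_of_nonneg_left (freqBound_nonneg _))

lemma exp_mul_sum_pow_le {n k : ℕ} (hn : 3 ≤ n) {α : ℝ}
    (hα : 1 / 20 < α) (hk : (k : ℝ) = α * (n : ℝ) ^ 2) :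
    Real.exp (α * Real.pi ^ 2 / 2) *
      ∑ j ∈ Finset.Ico 1 n, ((3 + Real.cos (2 * Real.pi * j / n)) / 4) ^ (2 * k) ≤ 4 := by
  rw [Finset.mul_sum]
  calc _ ≤ ∑ j ∈ Finset.Ico 1 n, (freqBound j + freqBound (n - j)) :=
        Finset.sum_le_sum fun j hj => by
          rw [Finset.mem_Ico] at hj
          exact exp_mul_pow_le hn hj.1 hj.2 hα hk
    _ = ∑ j ∈ Finset.Ico 1 n, freqBound j + ∑ j ∈ Finset.Ico 1 n, freqBound j := by
        rw [Finset.sum_add_distrib]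
        congr 1
        refine Finset.sum_bij' (fun j _ => n - j) (fun j _ => n - j) ?_ ?_ ?_ ?_ ?_ <;>
          intro j hj <;> simp only [Finset.mem_Ico] at hj ⊢ <;> omega
    _ ≤ 4 := by linarith [sum_freqBound_le n]

/-- Since π²/2 < n² log 2, the exponential is at most 2^k, leaving n² 2^{-k}; then 2^k ≥ k²/2 ≥
n⁴/800. -/
lemma exp_mul_quarter_pow_le {n k : ℕ} (hn : 3 ≤ n) {α : ℝ}
    (hα : 1 / 20 < α) (hk : (k : ℝ) = α * (n : ℝ) ^ 2) :
    Real.exp (α * Real.pi ^ 2 / 2) * (n ^ 2 * (1 / 4 : ℝ) ^ k) ≤ 800 / n ^ 2 := by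
  have hn' : (3 : ℝ) ≤ n := by exact_mod_cast hn
  have hn0 : (0 : ℝ) < n := by linarith
  have h1 : Real.exp (α * Real.pi ^ 2 / 2) ≤ 2 ^ k := by
    have h : α * Real.pi ^ 2 / 2 ≤ k * Real.log 2 := by
      rw [hk, mul_assoc, mul_div_assoc]
      refine mul_le_mul_of_nonneg_left ?_ (by linarith)
      have := Real.log_two_gt_d9
      have := pi_sq_lt
      nlinarith
    calc _ ≤ Real.exp (k * Real.log 2) := Real.exp_le_exp.2 h
      _ = 2 ^ k := by rw [Real.exp_nat_mul, Real.exp_log two_pos]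
  have hk0 : (n : ℝ) ^ 2 / 20 ≤ k := by rw [hk]; nlinarith
  have h2 : ((n : ℝ) ^ 2 / 20) ^ 2 ≤ 2 * 2 ^ k :=
    (pow_le_pow_left₀ (by positivity) hk0 2).trans (sq_le_two_mul_two_pow k)
  have h3 : (2 : ℝ) ^ k * (1 / 4) ^ k * 2 ^ k = 1 := by
    rw [← mul_pow, ← mul_pow]; norm_num
  rw [le_div_iff₀ (by positivity)]
  have hq : (0 : ℝ) < (1 / 4) ^ k := by positivity
  calc Real.exp (α * Real.pi ^ 2 / 2) * (n ^ 2 * (1 / 4 : ℝ) ^ k) * n ^ 2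
      ≤ 2 ^ k * (n ^ 2 * (1 / 4 : ℝ) ^ k) * n ^ 2 := by gcongr
    _ = 400 * (2 ^ k * (1 / 4 : ℝ) ^ k * ((n : ℝ) ^ 2 / 20) ^ 2) := by ring
    _ ≤ 400 * (2 ^ k * (1 / 4 : ℝ) ^ k * (2 * 2 ^ k)) := by gcongr
    _ = 800 := by linear_combination 800 * h3

end Sekine

/-! ### Total variation: Plancherel upper bound and test projections -/

namespace Sekine

noncomputable section

variable {n : ℕ} [NeZero n]

lemma sum_norm_sq_char_mul (f : ZMod n → ℂ) :
    ∑ i, ‖∑ s, ZMod.stdAddChar (s * i) * f s‖ ^ 2 = n * ∑ s, ‖f s‖ ^ 2 := by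
  have h : ∀ i : ZMod n, (‖∑ s, ZMod.stdAddChar (s * i) * f s‖ ^ 2 : ℂ) =
      ∑ s, ∑ t, f s * (starRingEnd ℂ) (f t) * ZMod.stdAddChar (i * (s - t)) := by
    intro i
    rw [← Complex.mul_conj', map_sum, Finset.sum_mul_sum]
    refine Finset.sum_congr rfl fun s _ => Finset.sum_congr rfl fun t _ => ?_
    have h1 : (ZMod.stdAddChar (i * (s - t)) : ℂ) =
        ZMod.stdAddChar (s * i) * (starRingEnd ℂ) (ZMod.stdAddChar (t * i)) := by
      rw [← AddChar.map_neg_eq_conj, ← AddChar.map_add_eq_mul]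
      congr 1
      ring
    rw [h1, (starRingEnd ℂ).map_mul]
    ring
  rw [← Complex.ofReal_inj]
  push_cast
  simp only [h]
  rw [Finset.sum_comm, Finset.mul_sum]
  refine Finset.sum_congr rfl fun s _ => ?_
  rw [Finset.sum_comm]
  simp only [← Finset.mul_sum, sum_char, sub_eq_zero, mul_ite, mul_zero, Finset.sum_ite_eq,
    Finset.mem_univ, if_true, Complex.mul_conj']
  ring

lemma sum_norm_sq_char_mul_two (F : ZMod n → ZMod n → ℂ) :
    ∑ i, ∑ j, ‖∑ s, ∑ t, ZMod.stdAddChar (s * i + t * j) * F s t‖ ^ 2 =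
      (n : ℝ) ^ 2 * ∑ s, ∑ t, ‖F s t‖ ^ 2 := by
  have h : ∀ i j : ZMod n, ∑ s, ∑ t, ZMod.stdAddChar (s * i + t * j) * F s t =
      ∑ s, ZMod.stdAddChar (s * i) * ∑ t, ZMod.stdAddChar (t * j) * F s t := by
    intro i j
    refine Finset.sum_congr rfl fun s _ => ?_
    rw [Finset.mul_sum]
    refine Finset.sum_congr rfl fun t _ => ?_
    rw [AddChar.map_add_eq_mul, mul_assoc]
  simp only [h]
  rw [Finset.sum_comm]
  simp only [sum_norm_sq_char_mul, ← Finset.mul_sum]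
  rw [Finset.sum_comm]
  simp only [sum_norm_sq_char_mul, ← Finset.mul_sum]
  ring

lemma norm_sum_mul_sq_le {ι : Type*} (s : Finset ι) (a b : ι → ℂ) :
    ‖∑ x ∈ s, a x * b x‖ ^ 2 ≤ (∑ x ∈ s, ‖a x‖ ^ 2) * ∑ x ∈ s, ‖b x‖ ^ 2 := by
  calc ‖∑ x ∈ s, a x * b x‖ ^ 2 ≤ (∑ x ∈ s, ‖a x‖ * ‖b x‖) ^ 2 := by
        gcongr
        exact (norm_sum_le _ _).trans_eq (by simp only [norm_mul])
    _ ≤ _ := Finset.sum_mul_sq_le_sq_mul_sq _ _ _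

lemma norm_sum_sum_mul_sq_le (a b : ZMod n → ZMod n → ℂ) :
    ‖∑ i, ∑ j, a i j * b i j‖ ^ 2 ≤ (∑ i, ∑ j, ‖a i j‖ ^ 2) * ∑ i, ∑ j, ‖b i j‖ ^ 2 := by
  have h := norm_sum_mul_sq_le Finset.univ (fun x : ZMod n × ZMod n => a x.1 x.2)
    (fun x => b x.1 x.2)
  simpa only [Fintype.sum_prod_type] using h

lemma fourierFun_apply (F : ZMod n → ZMod n → ℂ) (b : ZMod n → ℂ) (u : FunAlg n) :
    fourierFun F b u = (∑ i, ∑ j, eDual i j u *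
        (1 / (n : ℂ) ^ 2 * ∑ s, ∑ t, ZMod.stdAddChar (s * i + t * j) * F s t)) +
      ∑ i, ∑ j, EDual i j u * (1 / (n : ℂ) * b (i - j)) := by
  simp only [fourierFun, linExt, LinearMap.sum_apply, LinearMap.add_apply,
    LinearMap.smulRight_apply, smul_eq_mul, Finset.sum_add_distrib]

lemma sum_norm_sq_eDual {u : FunAlg n} (hu : star u * u = 1) :
    ∑ i, ∑ j, ‖eDual i j u‖ ^ 2 = (n : ℝ) ^ 2 := by
  have h : ∀ i j : ZMod n, ‖eDual i j u‖ ^ 2 = 1 := by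
    intro i j
    have h1 := eDual_star_mul_self u i j
    rw [hu, eDual_one] at h1
    rw [← Complex.normSq_eq_norm_sq]
    exact_mod_cast h1.symm
  simp [h, ZMod.card, sq]

lemma sum_norm_sq_EDual {u : FunAlg n} (hu : star u * u = 1) :
    ∑ i, ∑ j, ‖EDual i j u‖ ^ 2 = (n : ℝ) := by
  have h := sum_EDual_star_mul_self u
  rw [hu] at h
  simp only [EDual_one, if_true, Finset.sum_const, Finset.card_univ, ZMod.card, nsmul_eq_mul,
    mul_one] at h
  rw [Finset.sum_comm]
  simp only [← Complex.normSq_eq_norm_sq]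
  exact_mod_cast h.symm

/-- Cauchy–Schwarz on each summand. The squared ℓ²-norms n² and n of the two components of u exactly
balance the normalisations 1/n² and 1/n after Plancherel; the factor 2 is (x + y)² ≤ 2(x² + y²). -/
lemma norm_fourierFun_sq_le (F : ZMod n → ZMod n → ℂ) (b : ZMod n → ℂ) {u : FunAlg n}
    (hu : star u * u = 1) :
    ‖fourierFun F b u‖ ^ 2 ≤ 2 * (∑ s, ∑ t, ‖F s t‖ ^ 2 + ∑ s, ‖b s‖ ^ 2) := by
  have hn : (n : ℝ) ≠ 0 := by exact_mod_cast NeZero.ne n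
  rw [fourierFun_apply]
  set x := ∑ i, ∑ j, eDual i j u *
        (1 / (n : ℂ) ^ 2 * ∑ s, ∑ t, ZMod.stdAddChar (s * i + t * j) * F s t) with hx
  set y := ∑ i, ∑ j, EDual i j u * (1 / (n : ℂ) * b (i - j)) with hy
  have h1 : ‖x‖ ^ 2 ≤ ∑ s, ∑ t, ‖F s t‖ ^ 2 := by
    refine (norm_sum_sum_mul_sq_le _ _).trans_eq ?_
    rw [sum_norm_sq_eDual hu]
    simp only [norm_mul, mul_pow, ← Finset.mul_sum, sum_norm_sq_char_mul_two]
    simp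
    field_simp
  have h2 : ‖y‖ ^ 2 ≤ ∑ s, ‖b s‖ ^ 2 := by
    refine (norm_sum_sum_mul_sq_le _ _).trans_eq ?_
    have h : ∀ l : ZMod n, ∑ m, ‖b (l - m)‖ ^ 2 = ∑ d, ‖b d‖ ^ 2 :=
      fun l => Equiv.sum_comp (Equiv.subLeft l) fun d => ‖b d‖ ^ 2
    rw [sum_norm_sq_EDual hu]
    simp only [norm_mul, mul_pow, ← Finset.mul_sum, h]
    simp [ZMod.card]
    field_simp
  have h3 : ‖x + y‖ ^ 2 ≤ (‖x‖ + ‖y‖) ^ 2 := by gcongr; exact norm_add_le _ _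
  nlinarith [sq_nonneg (‖x‖ - ‖y‖)]

lemma sum_char_mul_char (a : ZMod n) (H : ZMod n → ℂ) :
    ∑ i, ZMod.stdAddChar (i * a) * (1 / (n : ℂ) * ∑ s, ZMod.stdAddChar (s * i) * H s) =
      H (-a) := by
  have hn : (n : ℂ) ≠ 0 := by exact_mod_cast NeZero.ne n
  have h : ∀ i : ZMod n, ZMod.stdAddChar (i * a) *
        (1 / (n : ℂ) * ∑ s, ZMod.stdAddChar (s * i) * H s) =
      ∑ s, 1 / (n : ℂ) * H s * ZMod.stdAddChar (i * (a + s)) := by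
    intro i
    simp only [Finset.mul_sum]
    refine Finset.sum_congr rfl fun s _ => ?_
    rw [mul_add, AddChar.map_add_eq_mul, mul_comm s i]
    ring
  simp only [h]
  rw [Finset.sum_comm]
  simp only [← Finset.mul_sum, sum_char, add_eq_zero_iff_eq_neg', mul_ite, mul_zero,
    Finset.sum_ite_eq', Finset.mem_univ, if_true]
  field_simp

/-- The projection onto the first coordinates in `A` and the spectral subset `B` of the algebra of
circulant matrices. -/
def testProj (A B : Finset (ZMod n)) : FunAlg n :=
  (fun p => if p.1 ∈ A then 1 else 0,
    Matrix.of fun p q => 1 / (n : ℂ) * ∑ i ∈ B, ZMod.stdAddChar (i * (p - q)))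

lemma eDual_testProj (A B : Finset (ZMod n)) (i j : ZMod n) :
    eDual i j (testProj A B) = if i ∈ A then 1 else 0 := rfl

lemma EDual_testProj (A B : Finset (ZMod n)) (p q : ZMod n) :
    EDual p q (testProj A B) = 1 / (n : ℂ) * ∑ i ∈ B, ZMod.stdAddChar (i * (p - q)) := rfl

/-- The matrix block is the sum over i in B of the rank-one projections onto the normalised
characters, which are mutually orthogonal. -/
lemma isStarProjection_testProj (A B : Finset (ZMod n)) : IsStarProjection (testProj A B) := by
  have hn : (n : ℂ) ≠ 0 := by exact_mod_cast NeZero.ne n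
  refine ⟨Prod.ext ?_ ?_, Prod.ext ?_ ?_⟩
  · funext p
    change (if p.1 ∈ A then (1 : ℂ) else 0) * (if p.1 ∈ A then 1 else 0) = if p.1 ∈ A then 1 else 0
    split_ifs <;> simp
  · ext p q
    refine (Matrix.mul_apply (M := (testProj A B).2) (N := (testProj A B).2)).trans ?_
    change ∑ r, (1 / (n : ℂ) * ∑ i ∈ B, ZMod.stdAddChar (i * (p - r))) *
      (1 / (n : ℂ) * ∑ i ∈ B, ZMod.stdAddChar (i * (r - q))) =
      1 / (n : ℂ) * ∑ i ∈ B, ZMod.stdAddChar (i * (p - q))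
    have h : ∀ r : ZMod n, (1 / (n : ℂ) * ∑ i ∈ B, ZMod.stdAddChar (i * (p - r))) *
        (1 / (n : ℂ) * ∑ i ∈ B, ZMod.stdAddChar (i * (r - q))) =
        ∑ i ∈ B, ∑ j ∈ B, 1 / (n : ℂ) ^ 2 * ZMod.stdAddChar (i * p - j * q) *
          ZMod.stdAddChar (r * (j - i)) := by
      intro r
      rw [mul_mul_mul_comm, Finset.sum_mul_sum, Finset.mul_sum]
      refine Finset.sum_congr rfl fun i _ => ?_
      rw [Finset.mul_sum]
      refine Finset.sum_congr rfl fun j _ => ?_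
      rw [mul_assoc (1 / (n : ℂ) ^ 2), ← AddChar.map_add_eq_mul, ← AddChar.map_add_eq_mul,
        show i * (p - r) + j * (r - q) = i * p - j * q + r * (j - i) by ring]
      ring
    simp only [h]
    rw [Finset.sum_comm, Finset.mul_sum]
    refine Finset.sum_congr rfl fun i hi => ?_
    rw [Finset.sum_comm]
    simp only [← Finset.mul_sum, sum_char, sub_eq_zero, mul_ite, mul_zero, Finset.sum_ite_eq',
      if_pos hi]
    rw [← mul_sub]
    field_simp
  · funext p
    change star (if p.1 ∈ A then (1 : ℂ) else 0) = if p.1 ∈ A then 1 else 0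
    split_ifs <;> simp
  · ext p q
    change (starRingEnd ℂ) (1 / (n : ℂ) * ∑ i ∈ B, ZMod.stdAddChar (i * (q - p))) =
      1 / (n : ℂ) * ∑ i ∈ B, ZMod.stdAddChar (i * (p - q))
    rw [map_mul, map_sum]
    congr 1
    · simp
    · refine Finset.sum_congr rfl fun i _ => ?_
      rw [← AddChar.map_neg_eq_conj, ← mul_neg, neg_sub]

/-- Independence of the second coordinate leaves only t = 0, and the circulant block reads off
Fourier transforms of b, so both summands become functions on the same group ℤ/n. -/
lemma fourierFun_testProj (F : ZMod n → ZMod n → ℂ) (b : ZMod n → ℂ) (A B : Finset (ZMod n)) :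
    fourierFun F b (testProj A B) =
      ∑ i ∈ A, (1 / (n : ℂ) * ∑ s, ZMod.stdAddChar (s * i) * F s 0) +
        ∑ i ∈ B, (1 / (n : ℂ) * ∑ s, ZMod.stdAddChar (s * i) * b s) := by
  have hn : (n : ℂ) ≠ 0 := by exact_mod_cast NeZero.ne n
  rw [fourierFun_apply]
  simp only [eDual_testProj, EDual_testProj]
  congr 1
  · have h : ∀ i : ZMod n, ∑ j,
      (1 / (n : ℂ) ^ 2 * ∑ s, ∑ t, ZMod.stdAddChar (s * i + t * j) * F s t) =
        1 / (n : ℂ) * ∑ s, ZMod.stdAddChar (s * i) * F s 0 := by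
      intro i
      rw [← Finset.mul_sum, Finset.sum_comm, Finset.mul_sum, Finset.mul_sum]
      refine Finset.sum_congr rfl fun s _ => ?_
      rw [Finset.sum_comm]
      have ht : ∀ t j : ZMod n, (ZMod.stdAddChar (s * i + t * j) : ℂ) * F s t =
          ZMod.stdAddChar (s * i) * F s t * ZMod.stdAddChar (j * t) := by
        intro t j
        rw [AddChar.map_add_eq_mul, mul_comm t j]
        ring
      simp only [ht, ← Finset.mul_sum, sum_char, mul_ite, mul_zero, Finset.sum_ite_eq',
        Finset.mem_univ, if_true]
      field_simp
    have h2 : ∀ i : ZMod n, ∑ j, (if i ∈ A then (1 : ℂ) else 0) *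
        (1 / (n : ℂ) ^ 2 * ∑ s, ∑ t, ZMod.stdAddChar (s * i + t * j) * F s t) =
        if i ∈ A then 1 / (n : ℂ) * ∑ s, ZMod.stdAddChar (s * i) * F s 0 else 0 := by
      intro i
      rw [← Finset.mul_sum, h, ite_mul, one_mul, zero_mul]
    simp only [h2, Finset.sum_ite_mem, Finset.univ_inter]
  · rw [sum_sum_sub fun d => 1 / (n : ℂ) * (∑ i ∈ B, ZMod.stdAddChar (i * d)) * (1 / (n : ℂ) * b d)]
    simp only [Finset.mul_sum, Finset.sum_mul]
    rw [Finset.sum_comm]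
    refine Finset.sum_congr rfl fun i _ => Finset.sum_congr rfl fun s _ => ?_
    rw [mul_comm s i]
    field_simp

lemma fourierFun_one (F : ZMod n → ZMod n → ℂ) (b : ZMod n → ℂ) :
    fourierFun F b 1 = F 0 0 + b 0 := by
  have hn : (n : ℂ) ≠ 0 := by exact_mod_cast NeZero.ne n
  rw [fourierFun_apply]
  simp only [eDual_one, EDual_one, ite_mul, one_mul, zero_mul, Finset.sum_ite_eq, Finset.mem_univ,
    if_true, sub_self]
  congr 1
  · have h := sum_char_mul_fourier 0 F
    simpa using h
  · simp [ZMod.card]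
    field_simp

/-- The difference φ of two states vanishes at 1, so φ(p) = φ(2p - 1)/2 with 2p - 1 a self-adjoint
unitary. The constant is 2/4. -/
lemma norm_convPow_sub_haarState_sq_le (k : ℕ) {p : FunAlg n} (hp : IsStarProjection p) :
    ‖FiniteQuantumGroup.convPow (walkState n) k p - haarState n p‖ ^ 2 ≤
      1 / 2 * (∑ s : ZMod n, ∑ t : ZMod n, diffComm k s t ^ 2 + ∑ s : ZMod n, diffMat k s ^ 2) := by
  rw [convPow_sub_haarState]
  set φ := fourierFun (fun s t : ZMod n => (diffComm k s t : ℂ)) (fun s => (diffMat k s : ℂ))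
    with hφ
  have h1 : φ 1 = 0 := by
    have h := diffComm_add_diffMat k (0 : ZMod n)
    rw [if_pos rfl] at h
    rw [hφ, fourierFun_one]
    exact_mod_cast h
  have hu : star (2 * p - 1) * (2 * p - 1) = 1 := by
    have h2 : star (2 : FunAlg n) = 2 := by simp
    have hs : star (2 * p - 1) = 2 * p - 1 := by
      rw [star_sub, star_one, two_mul, star_add, hp.isSelfAdjoint.star_eq]
    have hpp : p * p = p := hp.isIdempotentElem
    rw [hs, two_mul, sub_mul, mul_sub, add_mul, mul_add, hpp]
    simp only [mul_one, one_mul]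
    abel
  have h := norm_fourierFun_sq_le (fun s t : ZMod n => (diffComm k s t : ℂ))
    (fun s => (diffMat k s : ℂ)) hu
  have hφp : φ (2 * p - 1) = 2 * φ p := by
    rw [map_sub, h1, sub_zero, two_mul, map_add, two_mul]
  rw [← hφ, hφp, norm_mul, mul_pow] at h
  simp only [Complex.norm_real, Real.norm_eq_abs, sq_abs] at h
  norm_num at h
  linarith

/-- An unbounded real supremum would take the default value 0, so lower bounds for `tvDist` rest on
this. -/
lemma bddAbove_tvDist (k : ℕ) : BddAbove (Set.range fun p : {p : FunAlg n // IsStarProjection p} =>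
    ‖FiniteQuantumGroup.convPow (walkState n) k p - haarState n p‖) := by
  refine ⟨√(1 / 2 * (∑ s : ZMod n, ∑ t : ZMod n, diffComm k s t ^ 2 +
    ∑ s : ZMod n, diffMat k s ^ 2)), ?_⟩
  rintro _ ⟨p, rfl⟩
  exact Real.le_sqrt_of_sq_le (norm_convPow_sub_haarState_sq_le k p.2)

lemma tvDist_sq_le (k : ℕ) :
    FiniteQuantumGroup.tvDist (FiniteQuantumGroup.convPow (walkState n) k) (haarState n) ^ 2 ≤
      1 / 2 * (∑ s : ZMod n, ∑ t : ZMod n, diffComm k s t ^ 2 + ∑ s : ZMod n, diffMat k s ^ 2) := by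
  have : Nonempty {p : FunAlg n // IsStarProjection p} := ⟨⟨_, isStarProjection_testProj ∅ ∅⟩⟩
  have h : FiniteQuantumGroup.tvDist (FiniteQuantumGroup.convPow (walkState n) k) (haarState n) ≤
      √(1 / 2 * (∑ s : ZMod n, ∑ t : ZMod n, diffComm k s t ^ 2 +
        ∑ s : ZMod n, diffMat k s ^ 2)) :=
    ciSup_le fun p => Real.le_sqrt_of_sq_le (norm_convPow_sub_haarState_sq_le k p.2)
  have h0 : 0 ≤ FiniteQuantumGroup.tvDist (FiniteQuantumGroup.convPow (walkState n) k)
      (haarState n) := Real.iSup_nonneg fun _ => norm_nonneg _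
  exact (Real.le_sqrt h0 (by positivity)).1 h

/-- Here w and v are the values of ν^{⋆k} - π on the spectral projections of the two summands. Their
sum has Fourier coefficients 0 at s = 0 and `eigPos s ^ k` elsewhere, so pairing it with (1 + cos)/2
gives half of `eigPos 1 ^ k`. -/
lemma half_eigPos_pow_le_tvDist (hn : 3 ≤ n) (k : ℕ) :
    1 / 2 * eigPos (1 : ZMod n) ^ k ≤
      FiniteQuantumGroup.tvDist (FiniteQuantumGroup.convPow (walkState n) k) (haarState n) := by
  have : Fact (1 < n) := ⟨by omega⟩
  let w : ZMod n → ℂ := fun i => 1 / (n : ℂ) * ∑ s, ZMod.stdAddChar (s * i) * (diffComm k s 0 : ℂ)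
  let v : ZMod n → ℂ := fun i => 1 / (n : ℂ) * ∑ s, ZMod.stdAddChar (s * i) * (diffMat k s : ℂ)
  let H : ZMod n → ℂ := fun s => ((if s = 0 then 0 else eigPos s ^ k : ℝ) : ℂ)
  have hwv : ∀ a : ZMod n, ∑ i, ZMod.stdAddChar (i * a) * (w i + v i) = H (-a) := by
    intro a
    rw [← sum_char_mul_char a H]
    refine Finset.sum_congr rfl fun i _ => ?_
    simp only [w, v, H, ← mul_add, ← Finset.sum_add_distrib, ← diffComm_add_diffMat]
    push_cast
    rfl
  have h0 : ∑ i, (w i + v i) = 0 := by simpa [H] using hwv 0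
  have h1 : ∑ i, (cosChar i : ℂ) * (w i + v i) = ((eigPos (1 : ZMod n) ^ k : ℝ) : ℂ) := by
    have ha := hwv 1
    have hb := hwv (-1)
    simp only [H, neg_neg, mul_one, mul_neg, neg_eq_zero, one_ne_zero, if_false] at ha hb
    have hc : eigPos (-1 : ZMod n) = eigPos (1 : ZMod n) := by rw [eigPos, eigPos, cosChar_neg]
    rw [hc] at ha
    have h2 : ∑ i, 2 * ((cosChar i : ℂ) * (w i + v i)) = 2 * ((eigPos (1 : ZMod n) ^ k : ℝ) : ℂ) := by
      rw [two_mul (Complex.ofReal _)]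
      nth_rewrite 1 [← ha]
      rw [← hb, ← Finset.sum_add_distrib]
      refine Finset.sum_congr rfl fun i _ => ?_
      rw [← add_mul, stdAddChar_add_neg, mul_assoc]
    rw [← Finset.mul_sum] at h2
    exact mul_left_cancel₀ two_ne_zero h2
  have h0' : ∑ i, ((w i).re + (v i).re) = 0 := by
    have := congrArg Complex.re h0
    simpa only [Complex.re_sum, Complex.add_re, Complex.zero_re] using this
  have h1' : ∑ i, cosChar i * ((w i).re + (v i).re) = eigPos (1 : ZMod n) ^ k := by
    have := congrArg Complex.re h1
    simpa only [Complex.re_sum, Complex.re_ofReal_mul, Complex.add_re, Complex.ofReal_re] using this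
  let A : Finset (ZMod n) := Finset.univ.filter fun i => 0 < (w i).re
  let B : Finset (ZMod n) := Finset.univ.filter fun i => 0 < (v i).re
  -- The weights lie in [0,1], so the indicator of the positive set does at least as well, and an
  -- indicator comes from a projection.
  have hpos : ∀ (x : ZMod n → ℝ), ∑ i, (1 + cosChar i) / 2 * x i ≤
      ∑ i ∈ Finset.univ.filter (fun i => 0 < x i), x i := by
    intro x
    rw [Finset.sum_filter]
    refine Finset.sum_le_sum fun i _ => ?_
    have := abs_le.1 (abs_cosChar_le i)
    split_ifs with h <;> nlinarith
  calc 1 / 2 * eigPos (1 : ZMod n) ^ k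
      = ∑ i, (1 + cosChar i) / 2 * (w i).re + ∑ i, (1 + cosChar i) / 2 * (v i).re := by
        trans 1 / 2 * (∑ i, ((w i).re + (v i).re) + ∑ i, cosChar i * ((w i).re + (v i).re))
        · rw [h0', h1', zero_add]
        rw [← Finset.sum_add_distrib, ← Finset.sum_add_distrib, Finset.mul_sum]
        exact Finset.sum_congr rfl fun i _ => by ring
    _ ≤ ∑ i ∈ A, (w i).re + ∑ i ∈ B, (v i).re := add_le_add (hpos _) (hpos _)
    _ = (fourierFun (fun s t : ZMod n => (diffComm k s t : ℂ)) (fun s => (diffMat k s : ℂ))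
          (testProj A B)).re := by
        rw [fourierFun_testProj, Complex.add_re, Complex.re_sum, Complex.re_sum]
    _ ≤ ‖FiniteQuantumGroup.convPow (walkState n) k (testProj A B) -
          haarState n (testProj A B)‖ := by
        rw [convPow_sub_haarState]
        exact Complex.re_le_norm _
    _ ≤ _ := le_ciSup (bddAbove_tvDist k) ⟨_, isStarProjection_testProj A B⟩

end

end Sekine

/-! ### The two bounds in terms of α -/

namespace Sekine

open Filter Topology

variable {n : ℕ} [NeZero n]

lemma eigNeg_sq_pow_le {m : ℕ} (k : ℕ) (s : ZMod m) : eigNeg s ^ (2 * k) ≤ (1 / 4 : ℝ) ^ k := by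
  have := abs_le.1 (abs_cosChar_le s)
  rw [pow_mul]
  refine pow_le_pow_left₀ (sq_nonneg _) ?_ k
  rw [eigNeg]
  nlinarith

/-- For s ≠ 0 the half sum and half difference have squares adding to half the sum of the squares.
At s = 0 both differences vanish, but only for k ≠ 0: `eigNeg 0` is 0, and 0 ^ 0 = 1. -/
lemma diffComm_sq_add_diffMat_sq_le {m k : ℕ} (hk : k ≠ 0) (s : ZMod m) :
    diffComm k s 0 ^ 2 + diffMat k s ^ 2 ≤
      (if s = 0 then 0 else eigPos s ^ (2 * k)) / 2 + (1 / 4 : ℝ) ^ k / 2 := by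
  by_cases hs : s = 0
  · subst hs
    have h0 : eigNeg (0 : ZMod m) = 0 := by simp [eigNeg, cosChar_zero]
    simp only [diffComm, diffMat, coeffComm, coeffMat, eigPos_zero, h0, zero_pow hk, one_pow,
      and_self, if_true]
    norm_num
    positivity
  · have h := eigNeg_sq_pow_le k s
    simp only [diffComm, diffMat, coeffComm, coeffMat, hs, false_and, if_false, if_true, sub_zero]
    rw [mul_comm, pow_mul] at h ⊢
    nlinarith

lemma diffComm_sq_le {m : ℕ} (k : ℕ) (s t : ZMod m) :
    diffComm k s t ^ 2 ≤ (if t = 0 then diffComm k s 0 ^ 2 else 0) + (1 / 4 : ℝ) ^ k := by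
  by_cases ht : t = 0
  · subst ht
    rw [if_pos rfl]
    exact le_add_of_nonneg_right (by positivity)
  · have h1 := abs_le.1 (abs_cosChar_le s)
    have h2 := abs_le.1 (abs_cosChar_le t)
    simp only [diffComm, coeffComm, ht, and_false, if_false, sub_zero, zero_add]
    rw [← pow_mul, mul_comm, pow_mul]
    refine pow_le_pow_left₀ (sq_nonneg _) ?_ k
    nlinarith

lemma sum_eigPos_pow (k : ℕ) :
    ∑ s : ZMod n, (if s = 0 then 0 else eigPos s ^ (2 * k)) =
      ∑ j ∈ Finset.Ico 1 n, ((3 + Real.cos (2 * Real.pi * j / n)) / 4) ^ (2 * k) := by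
  simp only [← ite_not (p := _ = _)]
  rw [← Finset.sum_filter]
  refine Finset.sum_nbij' (fun s : ZMod n => s.val) (fun j : ℕ => (j : ZMod n)) ?_ ?_ ?_ ?_ ?_
  · intro s hs
    simp only [Finset.mem_filter, Finset.mem_univ, true_and] at hs
    exact Finset.mem_Ico.2 ⟨Nat.one_le_iff_ne_zero.2 ((ZMod.val_ne_zero s).2 hs), ZMod.val_lt s⟩
  · intro j hj
    rw [Finset.mem_Ico] at hj
    simp only [Finset.mem_filter, Finset.mem_univ, true_and]
    rw [← ZMod.val_eq_zero, ZMod.val_natCast_of_lt hj.2]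
    omega
  · intro s _
    exact ZMod.natCast_zmod_val s
  · intro j hj
    exact ZMod.val_natCast_of_lt (Finset.mem_Ico.1 hj).2
  · intro s _
    rfl

lemma sum_diff_sq_le {k : ℕ} (hk : k ≠ 0) :
    ∑ s : ZMod n, ∑ t : ZMod n, diffComm k s t ^ 2 + ∑ s : ZMod n, diffMat k s ^ 2 ≤
      (∑ j ∈ Finset.Ico 1 n, ((3 + Real.cos (2 * Real.pi * j / n)) / 4) ^ (2 * k)) / 2 +
        2 * (n ^ 2 * (1 / 4 : ℝ) ^ k) := by
  have hn1 : (1 : ℝ) ≤ n := by exact_mod_cast NeZero.one_le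
  have h1 : ∑ s : ZMod n, ∑ t : ZMod n, diffComm k s t ^ 2 ≤
      ∑ s : ZMod n, diffComm k s 0 ^ 2 + n ^ 2 * (1 / 4 : ℝ) ^ k := by
    refine (Finset.sum_le_sum fun s _ => Finset.sum_le_sum fun t _ => diffComm_sq_le k s t).trans_eq
      ?_
    simp [Finset.sum_add_distrib, ZMod.card]
    ring
  have h2 := Finset.sum_le_sum fun s (_ : s ∈ Finset.univ) =>
    diffComm_sq_add_diffMat_sq_le (m := n) hk s
  rw [Finset.sum_add_distrib, Finset.sum_add_distrib, ← Finset.sum_div, sum_eigPos_pow] at h2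
  simp only [Finset.sum_const, Finset.card_univ, ZMod.card, nsmul_eq_mul] at h2
  have hq : (0 : ℝ) < (1 / 4) ^ k := by positivity
  have h3 : (n : ℝ) * (1 / 4) ^ k ≤ n ^ 2 * (1 / 4) ^ k := by
    gcongr
    nlinarith
  have h4 : (0 : ℝ) < n * (1 / 4) ^ k := by positivity
  linarith

theorem tvDist_walkState_le (hn : 3 ≤ n) {α : ℝ} {k : ℕ} (hα : 1 / 20 < α)
    (hk : (k : ℝ) = α * (n : ℝ) ^ 2) :
    FiniteQuantumGroup.tvDist (FiniteQuantumGroup.convPow (walkState n) k) (haarState n) ≤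
      (1 + 800 / (n : ℝ) ^ 2) * Real.exp (-(α * Real.pi ^ 2 / 4)) := by
  have hn' : (3 : ℝ) ≤ n := by exact_mod_cast hn
  have hk0 : k ≠ 0 := by
    rintro rfl
    have : 0 < α * (n : ℝ) ^ 2 := by positivity
    rw [Nat.cast_zero] at hk
    linarith
  refine le_of_sq_le_sq ?_ (by positivity)
  refine (tvDist_sq_le k).trans ?_
  have h1 := sum_diff_sq_le (n := n) hk0
  have h2 := exp_mul_sum_pow_le hn hα hk
  have h3 := exp_mul_quarter_pow_le hn hα hk
  set S := ∑ j ∈ Finset.Ico 1 n, ((3 + Real.cos (2 * Real.pi * j / n)) / 4) ^ (2 * k)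
  set Q := (n : ℝ) ^ 2 * (1 / 4 : ℝ) ^ k
  set T := ∑ s : ZMod n, ∑ t : ZMod n, diffComm k s t ^ 2 + ∑ s : ZMod n, diffMat k s ^ 2
  set c := 800 / (n : ℝ) ^ 2
  have hc : 0 ≤ c := by positivity
  have hX : 0 < Real.exp (α * Real.pi ^ 2 / 2) := Real.exp_pos _
  -- T/2 ≤ S/4 + Q, and the exponential times S is at most 4 and times Q at most c, so the left side
  -- is at most 1 + c.
  have h4 : Real.exp (α * Real.pi ^ 2 / 2) * (1 / 2 * T) ≤ (1 + c) ^ 2 := by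
    nlinarith [mul_le_mul_of_nonneg_left h1 hX.le]
  have h5 : Real.exp (-(α * Real.pi ^ 2 / 4)) ^ 2 = (Real.exp (α * Real.pi ^ 2 / 2))⁻¹ := by
    rw [← Real.exp_nat_mul, ← Real.exp_neg]
    congr 1
    push_cast
    ring
  rw [mul_pow, h5, ← div_eq_mul_inv, le_div_iff₀ hX]
  linarith

/-- By the double-angle formula `eigPos 1` is (1 + cos²(π/n))/2, the right side of
`exp_neg_sq_div_two_le`. -/
theorem le_tvDist_walkState (hn : 3 ≤ n) (k : ℕ) :
    1 / 2 * Real.exp (-(k * Real.pi ^ 2 / (2 * n ^ 2))) ≤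
      FiniteQuantumGroup.tvDist (FiniteQuantumGroup.convPow (walkState n) k) (haarState n) := by
  refine le_trans ?_ (half_eigPos_pow_le_tvDist hn k)
  have h1 : eigPos (1 : ZMod n) = (1 + Real.cos (Real.pi / n) ^ 2) / 2 := by
    rw [eigPos, cosChar, ZMod.val_one'' (by omega), Nat.cast_one,
      show 2 * Real.pi * 1 / n = 2 * (Real.pi / n) by ring, Real.cos_two_mul]
    ring
  have h2 := pow_le_pow_left₀ (Real.exp_pos _).le
    (exp_neg_sq_div_two_le (x := Real.pi / n) (by positivity)) k
  rw [← Real.exp_nat_mul] at h2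
  rw [h1]
  gcongr
  refine le_of_eq_of_le ?_ h2
  congr 1
  field_simp

/-! ### Absence of cut-off -/

lemma tendsto_one_add_div_sq :
    Tendsto (fun n : ℕ => 1 + 800 / (n : ℝ) ^ 2) atTop (𝓝 1) := by
  have h : Tendsto (fun n : ℕ => 800 / (n : ℝ) ^ 2) atTop (𝓝 0) :=
    tendsto_const_nhds.div_atTop
      ((tendsto_pow_atTop two_ne_zero).comp tendsto_natCast_atTop_atTop)
  simpa using h.const_add 1

lemma two_mul_exp_neg_pi_sq_div_four_lt : 2 * Real.exp (-(Real.pi ^ 2 / 4)) < 7 / 10 := by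
  have h1 := Real.add_one_le_exp (Real.pi ^ 2 / 4)
  have h2 := Real.pi_gt_three
  have h3 : (3 : ℝ) < Real.exp (Real.pi ^ 2 / 4) := by nlinarith
  rw [Real.exp_neg, ← div_eq_mul_inv, div_lt_iff₀ (by positivity)]
  linarith

/-- With ε = 1/2 the hypothetical cut-off window runs from t/2 to 3t/2, a bounded ratio, over which
the lower bound cannot drop to 0. The index m stands for n = 2m + 3. -/
theorem not_hasCutoff_walkState :
    ¬ FiniteQuantumGroup.HasCutoff (fun m k => FiniteQuantumGroup.tvDist
      (FiniteQuantumGroup.convPow (walkState (2 * m + 3)) k) (haarState (2 * m + 3))) := by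
  rintro ⟨t, ht, hcut⟩
  obtain ⟨h1, h0⟩ := hcut (1 / 2) (by norm_num) (by norm_num)
  have hc : Tendsto (fun m : ℕ => 1 + 800 / ((2 * m + 3 : ℕ) : ℝ) ^ 2) atTop (𝓝 1) :=
    tendsto_one_add_div_sq.comp
      (tendsto_atTop_mono (fun m => (by omega : m ≤ 2 * m + 3)) tendsto_id)
  have e1 := h1.eventually (lt_mem_nhds (show (7 / 10 : ℝ) < 1 by norm_num))
  have e0 := h0.eventually (gt_mem_nhds
    (show (0 : ℝ) < 1 / 2 * Real.exp (-(2 * Real.pi ^ 2)) by positivity))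
  have e2 := hc.eventually (gt_mem_nhds (show (1 : ℝ) < 2 by norm_num))
  obtain ⟨m, hm1, hm0, hm2⟩ := (e1.and (e0.and e2)).exists
  have hn : 3 ≤ 2 * m + 3 := by omega
  have hn' : (3 : ℝ) ≤ ((2 * m + 3 : ℕ) : ℝ) := by exact_mod_cast hn
  set N : ℝ := ((2 * m + 3 : ℕ) : ℝ) with hN
  have htm := ht m
  -- After N² or more steps α ≥ 1, and the upper bound, with c below 2, is less than 7/10; but at
  -- t/2 the distance exceeds 7/10.
  have hlt : (⌊(1 - 1 / 2) * t m⌋₊ : ℝ) < N ^ 2 := by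
    by_contra! hge
    set k := ⌊(1 - 1 / 2) * t m⌋₊ with hk
    have hα : 1 ≤ (k : ℝ) / N ^ 2 := by rwa [le_div_iff₀ (by positivity), one_mul]
    have hu := tvDist_walkState_le hn (α := (k : ℝ) / N ^ 2) (k := k) (by linarith)
      (by rw [← hN]; field_simp)
    have hexp : Real.exp (-((k : ℝ) / N ^ 2 * Real.pi ^ 2 / 4)) ≤
        Real.exp (-(Real.pi ^ 2 / 4)) := by
      rw [Real.exp_le_exp]
      nlinarith [sq_nonneg Real.pi]
    have := two_mul_exp_neg_pi_sq_div_four_lt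
    have : (1 + 800 / N ^ 2) * Real.exp (-((k : ℝ) / N ^ 2 * Real.pi ^ 2 / 4)) ≤
        2 * Real.exp (-(Real.pi ^ 2 / 4)) := by gcongr
    linarith
  have hfl := Nat.lt_floor_add_one ((1 - 1 / 2) * t m)
  -- From t/2 < N² + 1 it follows that 3t/2 < 3N² + 3 ≤ 4N². At 4N² steps the lower bound is
  -- e^{-2π²}/2, the threshold chosen in `e0`.
  have hle : (⌊(1 + 1 / 2) * t m⌋₊ : ℝ) ≤ 4 * N ^ 2 := by
    refine (Nat.floor_le (by positivity)).trans ?_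
    nlinarith
  have hl := le_tvDist_walkState hn ⌊(1 + 1 / 2) * t m⌋₊
  have hexp : Real.exp (-(2 * Real.pi ^ 2)) ≤
      Real.exp (-(⌊(1 + 1 / 2) * t m⌋₊ * Real.pi ^ 2 / (2 * N ^ 2))) := by
    rw [Real.exp_le_exp, neg_le_neg_iff, div_le_iff₀ (by positivity)]
    nlinarith [sq_nonneg Real.pi]
  linarith

end Sekine

theorem mainTheorem6 :
    (∃ c : ℕ → ℝ, Filter.Tendsto c Filter.atTop (nhds 1) ∧
      ∀ (n : ℕ) [NeZero n], Odd n → 3 ≤ n →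
        ∀ (α : ℝ) (k : ℕ), 1 / 20 < α → (k : ℝ) = α * (n : ℝ) ^ 2 →
          1 / 2 * Real.exp (-(α * Real.pi ^ 2 / 2)) ≤
              FiniteQuantumGroup.tvDist
                (FiniteQuantumGroup.convPow (Sekine.walkState n) k) (Sekine.haarState n) ∧
            FiniteQuantumGroup.tvDist
                (FiniteQuantumGroup.convPow (Sekine.walkState n) k) (Sekine.haarState n) ≤
              c n * Real.exp (-(α * Real.pi ^ 2 / 4))) ∧
    ¬ FiniteQuantumGroup.HasCutoff (fun m k =>
        FiniteQuantumGroup.tvDist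
          (FiniteQuantumGroup.convPow (Sekine.walkState (2 * m + 3)) k)
          (Sekine.haarState (2 * m + 3))) := by
  refine ⟨⟨fun n => 1 + 800 / (n : ℝ) ^ 2, Sekine.tendsto_one_add_div_sq,
    fun n _ _ hn α k hα hk => ⟨?_, Sekine.tvDist_walkState_le hn hα hk⟩⟩,
    Sekine.not_hasCutoff_walkState⟩
  refine le_of_eq_of_le ?_ (Sekine.le_tvDist_walkState hn k)
  have hn0 : (n : ℝ) ≠ 0 := by exact_mod_cast NeZero.ne n
  rw [hk]
  congr 3
  field_simp
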